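/- Let $M$ be a connected smooth manifold of dimension $n\ge 2$ with an LP-Kenmotsu (Lorentzian para-Kenmotsu) structure. That is, $M$ carries a Lorentzian metric $g$ of signature $(-,+,\dots,+)$, a smooth $(1,1)$-tensor field $\varphi$, a smooth vector field $\zeta$ and a smooth 1-form $\nu$ such that for all vector fields $E,F$ $$\nu(\zeta)=-1,\quad \varphi^2E=E+\nu(E)\zeta,\quad \varphi\zeta=0,\quad \nu(\varphi E)=0,$$ $$g(\varphi E,\varphi F)=g(E,F)+\nu(E)\nu(F),\quad g(E,\zeta)=\nu(E),\quad g(E,\varphi F)=g(F,\varphi E),$$ and $$(\nabla_E\varphi)F=-g(\varphi E,F)\,\zeta-\nu(F)\,\varphi E,$$ where $\nabla$ is the Levi-Civita connection of $g$. Let $S$ be the Ricci tensor and $r$ the scalar curvature of $g$, and suppose that $r$ is constant. Let $\sigma,\rho,\Lambda\in\mathbb R$ and let $v$ be a smooth function on $M$ such that $g$ is a gradient Ricci-Yamabe soliton with potential function $v$, that is, $$\operatorname{Hess} v+\sigma S+\Big(\Lambda-\frac{\rho r}{2}\Big)g=0,\qquad \operatorname{Hess}v=\nabla\nabla v .$$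 Then $v$ is constant, i.e. the soliton is trivial. -/

import Mathlib

open Bundle FiberBundle VectorField Module
open scoped Manifold ContDiff

/-- A smooth Lorentzian metric (signature `(-,+,…,+)`) on a smooth manifold modelled on `E`. -/
structure LorentzianMetric (E : Type*) [NormedAddCommGroup E] [NormedSpace ℝ E]
    (M : Type*) [TopologicalSpace M] [ChartedSpace E M] [IsManifold 𝓘(ℝ, E) ∞ M] where
  val : ∀ x : M, TangentSpace 𝓘(ℝ, E) x →L[ℝ] TangentSpace 𝓘(ℝ, E) x →L[ℝ] ℝ
  contMDiff : ContMDiff 𝓘(ℝ, E) (𝓘(ℝ, E).prod 𝓘(ℝ, E →L[ℝ] E →L[ℝ] ℝ)) ∞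
    (fun x ↦ TotalSpace.mk' (E →L[ℝ] E →L[ℝ] ℝ) x (val x))
  symm : ∀ x u w, val x u w = val x w u
  lorentzian : ∀ x, ∃ u, val x u u < 0 ∧ ∀ w, val x u w = 0 → w ≠ 0 → 0 < val x w w

namespace LorentzianMetric

section

variable {E : Type*} [NormedAddCommGroup E] [NormedSpace ℝ E]
  {M : Type*} [TopologicalSpace M] [ChartedSpace E M] [IsManifold 𝓘(ℝ, E) ∞ M]

theorem eq_zero_of_forall (g : LorentzianMetric E M) {x : M} {u : TangentSpace 𝓘(ℝ, E) x}
    (h : ∀ w, g.val x u w = 0) : u = 0 := by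
  obtain ⟨t, ht, hpos⟩ := g.lorentzian x
  by_contra hu
  have := hpos u (by rw [g.symm]; exact h t) hu
  rw [h u] at this
  exact lt_irrefl _ this

theorem ext_of_forall (g : LorentzianMetric E M) {x : M} {u v : TangentSpace 𝓘(ℝ, E) x}
    (h : ∀ w, g.val x u w = g.val x v w) : u = v := by
  have : u - v = 0 := g.eq_zero_of_forall fun w ↦ by
    rw [map_sub, sub_apply, h w, sub_self]
  exact sub_eq_zero.mp this

theorem mdifferentiableAt_apply (g : LorentzianMetric E M) {x : M}
    {X Y : ∀ x : M, TangentSpace 𝓘(ℝ, E) x}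
    (hX : MDiffAt (T% X) x) (hY : MDiffAt (T% Y) x) :
    MDiffAt (fun y ↦ g.val y (X y) (Y y)) x := by
  have : MDifferentiableAt 𝓘(ℝ, E) (𝓘(ℝ, E).prod 𝓘(ℝ))
      (fun m ↦ TotalSpace.mk' ℝ (E := Bundle.Trivial M ℝ) m (g.val m (X m) (Y m))) x := by
    apply MDifferentiableAt.clm_bundle_apply₂ (F₁ := E) (F₂ := E)
    · exact (g.contMDiff x).mdifferentiableAt (by simp)
    · exact hX
    · exact hY
  simp only [mdifferentiableAt_totalSpace] at this
  exact this.2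

/-- The six-term expression of the Koszul formula, `2 g(∇_X Y, Z)`; used only to construct the
Levi-Civita connection. -/
noncomputable def koszul (g : LorentzianMetric E M) (X Y Z : ∀ x : M, TangentSpace 𝓘(ℝ, E) x)
    (x : M) : ℝ :=
  mvfderiv 𝓘(ℝ, E) (fun y ↦ g.val y (Y y) (Z y)) x (X x)
    + mvfderiv 𝓘(ℝ, E) (fun y ↦ g.val y (X y) (Z y)) x (Y x)
    - mvfderiv 𝓘(ℝ, E) (fun y ↦ g.val y (X y) (Y y)) x (Z x)
    + g.val x (mlieBracket 𝓘(ℝ, E) X Y x) (Z x)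
    - g.val x (mlieBracket 𝓘(ℝ, E) X Z x) (Y x)
    - g.val x (mlieBracket 𝓘(ℝ, E) Y Z x) (X x)

variable [FiniteDimensional ℝ E]

section
variable (g : LorentzianMetric E M) {x : M} {X X' Y Y' Z : ∀ x : M, TangentSpace 𝓘(ℝ, E) x}
  {f : M → ℝ}

theorem koszul_add_left (hX : MDiffAt (T% X) x) (hX' : MDiffAt (T% X') x) (hY : MDiffAt (T% Y) x)
    (hZ : MDiffAt (T% Z) x) : g.koszul (X + X') Y Z x = g.koszul X Y Z x + g.koszul X' Y Z x := by
  have := FiniteDimensional.complete ℝ E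
  simp only [koszul, Pi.add_apply, map_add, add_apply,
    mlieBracket_add_left hX hX',
    mvfderiv_fun_add (g.mdifferentiableAt_apply hX hZ) (g.mdifferentiableAt_apply hX' hZ),
    mvfderiv_fun_add (g.mdifferentiableAt_apply hX hY) (g.mdifferentiableAt_apply hX' hY)]
  ring

theorem koszul_add_mid (hX : MDiffAt (T% X) x) (hY' : MDiffAt (T% Y') x) (hY : MDiffAt (T% Y) x)
    (hZ : MDiffAt (T% Z) x) : g.koszul X (Y + Y') Z x = g.koszul X Y Z x + g.koszul X Y' Z x := by
  have := FiniteDimensional.complete ℝ E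
  simp only [koszul, Pi.add_apply, map_add, add_apply,
    mlieBracket_add_left hY hY', mlieBracket_add_right hY hY',
    mvfderiv_fun_add (g.mdifferentiableAt_apply hY hZ) (g.mdifferentiableAt_apply hY' hZ),
    mvfderiv_fun_add (g.mdifferentiableAt_apply hX hY) (g.mdifferentiableAt_apply hX hY')]
  ring

theorem koszul_add_right (hX : MDiffAt (T% X) x) (hY' : MDiffAt (T% Y') x) (hY : MDiffAt (T% Y) x)
    (hZ : MDiffAt (T% Z) x) : g.koszul X Z (Y + Y') x = g.koszul X Z Y x + g.koszul X Z Y' x := by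
  have := FiniteDimensional.complete ℝ E
  simp only [koszul, Pi.add_apply, map_add, add_apply,
    mlieBracket_add_right hY hY',
    mvfderiv_fun_add (g.mdifferentiableAt_apply hZ hY) (g.mdifferentiableAt_apply hZ hY'),
    mvfderiv_fun_add (g.mdifferentiableAt_apply hX hY) (g.mdifferentiableAt_apply hX hY')]
  ring

theorem koszul_smul_left (hf : MDiffAt f x) (hX : MDiffAt (T% X) x) (hY : MDiffAt (T% Y) x)
    (hZ : MDiffAt (T% Z) x) : g.koszul (f • X) Y Z x = f x * g.koszul X Y Z x := by
  have := FiniteDimensional.complete ℝ E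
  simp only [koszul, Pi.smul_apply', map_smul, map_add, map_neg, add_apply,
    smul_apply, neg_apply, neg_smul,
    mlieBracket_smul_left hf hX, smul_eq_mul,
    mvfderiv_fun_mul hf (g.mdifferentiableAt_apply hX hZ),
    mvfderiv_fun_mul hf (g.mdifferentiableAt_apply hX hY)]
  rw [g.symm x (X x) (Z x), g.symm x (X x) (Y x)]
  ring

theorem koszul_smul_mid (hf : MDiffAt f x) (hX : MDiffAt (T% X) x) (hY : MDiffAt (T% Y) x)
    (hZ : MDiffAt (T% Z) x) : g.koszul X (f • Y) Z x =
      f x * g.koszul X Y Z x + 2 * mvfderiv 𝓘(ℝ, E) f x (X x) * g.val x (Y x) (Z x) := by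
  have := FiniteDimensional.complete ℝ E
  simp only [koszul, Pi.smul_apply', map_smul, map_add, map_neg, add_apply,
    smul_apply, neg_apply,
    mlieBracket_smul_left hf hY, mlieBracket_smul_right hf hY, smul_eq_mul, neg_smul,
    mvfderiv_fun_mul hf (g.mdifferentiableAt_apply hX hY),
    mvfderiv_fun_mul hf (g.mdifferentiableAt_apply hY hZ)]
  rw [g.symm x (Y x) (X x)]
  ring

theorem koszul_smul_right (hf : MDiffAt f x) (hX : MDiffAt (T% X) x) (hY : MDiffAt (T% Y) x)
    (hZ : MDiffAt (T% Z) x) : g.koszul X Y (f • Z) x = f x * g.koszul X Y Z x := by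
  have := FiniteDimensional.complete ℝ E
  simp only [koszul, Pi.smul_apply', map_smul, map_add, add_apply,
    smul_apply,
    mlieBracket_smul_right hf hZ, smul_eq_mul,
    mvfderiv_fun_mul hf (g.mdifferentiableAt_apply hX hZ),
    mvfderiv_fun_mul hf (g.mdifferentiableAt_apply hY hZ)]
  rw [g.symm x (Z x) (X x), g.symm x (Z x) (Y x)]
  ring

theorem exists_koszul_vector (Y : ∀ x : M, TangentSpace 𝓘(ℝ, E) x) (x : M)
    (hY : MDiffAt (T% Y) x) :
    ∃ A : TangentSpace 𝓘(ℝ, E) x →L[ℝ] TangentSpace 𝓘(ℝ, E) x,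
      ∀ X Z : ∀ x : M, TangentSpace 𝓘(ℝ, E) x, MDiffAt (T% X) x → MDiffAt (T% Z) x →
        2 * g.val x (A (X x)) (Z x) = g.koszul X Y Z x := by
  have hc := FiniteDimensional.complete ℝ E
  have hfin : FiniteDimensional ℝ (TangentSpace 𝓘(ℝ, E) x) :=
    inferInstanceAs (FiniteDimensional ℝ E)
  have h₁ : ∀ Z : (∀ x : M, TangentSpace 𝓘(ℝ, E) x), MDiffAt (T% Z) x →
      TensorialAt 𝓘(ℝ, E) E (fun X : (∀ x : M, TangentSpace 𝓘(ℝ, E) x) ↦ g.koszul X Y Z x) x :=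
    fun Z hZ ↦ ⟨fun hf hX ↦ g.koszul_smul_left hf hX hY hZ,
      fun hX hX' ↦ g.koszul_add_left hX hX' hY hZ⟩
  have h₂ : ∀ X : (∀ x : M, TangentSpace 𝓘(ℝ, E) x), MDiffAt (T% X) x →
      TensorialAt 𝓘(ℝ, E) E (fun Z : (∀ x : M, TangentSpace 𝓘(ℝ, E) x) ↦ g.koszul X Y Z x) x :=
    fun X hX ↦ ⟨fun hf hZ ↦ g.koszul_smul_right hf hX hY hZ,
      fun hZ hZ' ↦ g.koszul_add_right hX hZ' hZ hY⟩
  let B : TangentSpace 𝓘(ℝ, E) x →L[ℝ] TangentSpace 𝓘(ℝ, E) x →L[ℝ] ℝ :=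
    TensorialAt.mkHom₂ (fun X Z ↦ g.koszul X Y Z x) x h₁ h₂
  let L : TangentSpace 𝓘(ℝ, E) x →ₗ[ℝ] Module.Dual ℝ (TangentSpace 𝓘(ℝ, E) x) :=
    { toFun := fun u ↦ (g.val x u).toLinearMap
      map_add' := fun u v ↦ by ext w; simp
      map_smul' := fun c v ↦ by ext w; simp }
  have hL : Function.Injective L := fun u v huv ↦
    g.ext_of_forall fun w ↦ by simpa [L] using congrArg (fun φ ↦ φ w) huv
  let e := LinearEquiv.ofInjectiveOfFinrankEq L hL (by rw [Subspace.dual_finrank_eq])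
  let B' : TangentSpace 𝓘(ℝ, E) x →ₗ[ℝ] Module.Dual ℝ (TangentSpace 𝓘(ℝ, E) x) :=
    { toFun := fun u ↦ (B u).toLinearMap
      map_add' := fun u v ↦ by ext w; simp
      map_smul' := fun c v ↦ by ext w; simp }
  let A₀ : TangentSpace 𝓘(ℝ, E) x →ₗ[ℝ] TangentSpace 𝓘(ℝ, E) x :=
    (1 / 2 : ℝ) • (e.symm.toLinearMap ∘ₗ B')
  have hA₀ : ∀ u w, 2 * g.val x (A₀ u) w = B u w := fun u w ↦ by
    have h : g.val x (e.symm (B' u)) w = B u w := by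
      have h' : L (e.symm (B' u)) = B' u := e.apply_symm_apply (B' u)
      exact congrArg (fun φ ↦ φ w) h'
    simp only [A₀, LinearMap.smul_apply, LinearMap.comp_apply, map_smul,
      smul_apply, LinearEquiv.coe_coe, h, smul_eq_mul]
    ring
  have hT : T2Space (TangentSpace 𝓘(ℝ, E) x) := inferInstanceAs (T2Space E)
  refine ⟨LinearMap.toContinuousLinearMap A₀, fun X Z hX hZ ↦ ?_⟩
  have := TensorialAt.mkHom₂_apply h₁ h₂ hX hZ
  rw [LinearMap.coe_toContinuousLinearMap', hA₀]
  exact this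

end

/-- `cov` is a Levi-Civita connection of `g`: it is torsion-free and `∇g = 0`.
In Mathlib's convention `cov Y x u` is `(∇_u Y)(x)`. -/
structure IsLeviCivita (g : LorentzianMetric E M)
    (cov : CovariantDerivative 𝓘(ℝ, E) E (TangentSpace 𝓘(ℝ, E) : M → Type _)) : Prop where
  torsion_free : ∀ (x : M) (X Y : ∀ x : M, TangentSpace 𝓘(ℝ, E) x),
    MDiffAt (T% X) x → MDiffAt (T% Y) x →
      cov Y x (X x) - cov X x (Y x) = mlieBracket 𝓘(ℝ, E) X Y x
  metric : ∀ (x : M) (u : TangentSpace 𝓘(ℝ, E) x) (X Y : ∀ x : M, TangentSpace 𝓘(ℝ, E) x),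
    MDiffAt (T% X) x → MDiffAt (T% Y) x →
      mvfderiv 𝓘(ℝ, E) (fun y ↦ g.val y (X y) (Y y)) x u =
        g.val x (cov X x u) (Y x) + g.val x (X x) (cov Y x u)

theorem exists_isLeviCivita (g : LorentzianMetric E M) : ∃ cov, g.IsLeviCivita cov := by
  classical
  have hc := FiniteDimensional.complete ℝ E
  choose A hA using g.exists_koszul_vector
  let D : (∀ x : M, TangentSpace 𝓘(ℝ, E) x) →
      ∀ x : M, TangentSpace 𝓘(ℝ, E) x →L[ℝ] TangentSpace 𝓘(ℝ, E) x :=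
    fun Y x ↦ if h : MDiffAt (T% Y) x then A Y x h else 0
  have hD : ∀ (x : M) (X Y Z : ∀ x : M, TangentSpace 𝓘(ℝ, E) x), MDiffAt (T% X) x →
      MDiffAt (T% Y) x → MDiffAt (T% Z) x →
      2 * g.val x (D Y x (X x)) (Z x) = g.koszul X Y Z x := fun x X Y Z hX hY hZ ↦ by
    simp only [D, dif_pos hY]
    exact hA Y x hY X Z hX hZ
  have key : ∀ (x : M) (Y : ∀ x : M, TangentSpace 𝓘(ℝ, E) x) (u w : TangentSpace 𝓘(ℝ, E) x),
      MDiffAt (T% Y) x → 2 * g.val x (D Y x u) w = g.koszul (extend E u) Y (extend E w) x :=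
    fun x Y u w hY ↦ by
      have := hD x (extend E u) Y (extend E w) (mdifferentiableAt_extend ..) hY
        (mdifferentiableAt_extend ..)
      simpa using this
  refine ⟨⟨D, ⟨?_, ?_⟩⟩, ?_, ?_⟩
  · intro Y Y' x hY hY' _
    ext u
    refine g.ext_of_forall fun w ↦ ?_
    have h := key x (Y + Y') u w (mdifferentiableAt_add_section hY hY')
    rw [g.koszul_add_mid (mdifferentiableAt_extend ..) hY' hY (mdifferentiableAt_extend ..),
      ← key x Y u w hY, ← key x Y' u w hY'] at h
    simp only [add_apply, map_add]
    linarith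
  · intro Y f x hY hf _
    ext u
    refine g.ext_of_forall fun w ↦ ?_
    have h := key x (f • Y) u w (hf.smul_section hY)
    rw [g.koszul_smul_mid hf (mdifferentiableAt_extend ..) hY (mdifferentiableAt_extend ..),
      ← key x Y u w hY] at h
    simp only [add_apply, smul_apply, map_add, map_smul,
      ContinuousLinearMap.smulRight_apply, smul_eq_mul, extend_apply_self] at h ⊢
    linarith
  · intro x X Y hX hY
    refine g.ext_of_forall fun w ↦ ?_
    have hw : MDiffAt (T% (extend E w : ∀ x : M, TangentSpace 𝓘(ℝ, E) x)) x :=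
      mdifferentiableAt_extend ..
    have h1 := hD x X Y (extend E w) hX hY hw
    have h2 := hD x Y X (extend E w) hY hX hw
    have hXY : (fun y ↦ g.val y (Y y) (X y)) = fun y ↦ g.val y (X y) (Y y) :=
      funext fun y ↦ g.symm ..
    have hsw : mlieBracket 𝓘(ℝ, E) Y X x = - mlieBracket 𝓘(ℝ, E) X Y x := mlieBracket_swap_apply
    simp only [koszul, hsw, map_neg, neg_apply, extend_apply_self, hXY]
      at h1 h2
    simp only [map_sub, sub_apply]
    linarith
  · intro x u X Y hX hY
    have hu : MDiffAt (T% (extend E u : ∀ x : M, TangentSpace 𝓘(ℝ, E) x)) x :=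
      mdifferentiableAt_extend ..
    have h1 := hD x (extend E u) X Y hu hX hY
    have h2 := hD x (extend E u) Y X hu hY hX
    have hXY : (fun y ↦ g.val y (Y y) (X y)) = fun y ↦ g.val y (X y) (Y y) :=
      funext fun y ↦ g.symm ..
    have hsw : mlieBracket 𝓘(ℝ, E) Y X x = - mlieBracket 𝓘(ℝ, E) X Y x := mlieBracket_swap_apply
    simp only [koszul, hsw, map_neg, neg_apply, extend_apply_self, hXY]
      at h1 h2
    rw [g.symm x (X x)]
    change _ = g.val x (D X x u) (Y x) + g.val x (D Y x u) (X x)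
    linarith

/-- The Levi-Civita connection is unique: two of them agree on differentiable vector fields. -/
theorem IsLeviCivita.unique {g : LorentzianMetric E M}
    {cov cov' : CovariantDerivative 𝓘(ℝ, E) E (TangentSpace 𝓘(ℝ, E) : M → Type _)}
    (h : g.IsLeviCivita cov) (h' : g.IsLeviCivita cov') {x : M}
    {Y : ∀ x : M, TangentSpace 𝓘(ℝ, E) x} (hY : MDiffAt (T% Y) x) : cov Y x = cov' Y x := by
  have aux : ∀ {c : CovariantDerivative 𝓘(ℝ, E) E (TangentSpace 𝓘(ℝ, E) : M → Type _)},
      g.IsLeviCivita c → ∀ u w : TangentSpace 𝓘(ℝ, E) x,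
      2 * g.val x (c Y x u) w = g.koszul (extend E u) Y (extend E w) x := by
    intro c hc u w
    have hu : MDiffAt (T% (extend E u : ∀ x : M, TangentSpace 𝓘(ℝ, E) x)) x :=
      mdifferentiableAt_extend ..
    have hw : MDiffAt (T% (extend E w : ∀ x : M, TangentSpace 𝓘(ℝ, E) x)) x :=
      mdifferentiableAt_extend ..
    have m1 := hc.metric x u _ _ hY hw
    have m2 := hc.metric x (Y x) _ _ hu hw
    have m3 := hc.metric x w _ _ hu hY
    simp only [koszul, ← hc.torsion_free x _ _ hu hY, ← hc.torsion_free x _ _ hu hw,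
      ← hc.torsion_free x _ _ hY hw, extend_apply_self, map_sub, sub_apply] at m1 m2 m3 ⊢
    rw [m1, m2, m3, g.symm x (Y x), g.symm x u, g.symm x u]
    ring
  ext u
  refine g.ext_of_forall fun w ↦ ?_
  linarith [aux h u w, aux h' u w]

/-- The Levi-Civita connection of `g`; `g.leviCivita Y x u` is `(∇_u Y)(x)`. -/
noncomputable def leviCivita (g : LorentzianMetric E M) :
    CovariantDerivative 𝓘(ℝ, E) E (TangentSpace 𝓘(ℝ, E) : M → Type _) :=
  g.exists_isLeviCivita.choose

theorem isLeviCivita_leviCivita (g : LorentzianMetric E M) : g.IsLeviCivita g.leviCivita :=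
  g.exists_isLeviCivita.choose_spec

/-- The curvature `R(X,Y)Z = ∇_X ∇_Y Z - ∇_Y ∇_X Z - ∇_[X,Y] Z`. -/
noncomputable def curvature (g : LorentzianMetric E M)
    (X Y Z : ∀ x : M, TangentSpace 𝓘(ℝ, E) x) (x : M) : TangentSpace 𝓘(ℝ, E) x :=
  g.leviCivita (fun y ↦ g.leviCivita Z y (Y y)) x (X x)
    - g.leviCivita (fun y ↦ g.leviCivita Z y (X y)) x (Y x)
    - g.leviCivita Z x (mlieBracket 𝓘(ℝ, E) X Y x)

/-- A basis of `T_x M`, used to write traces. -/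
noncomputable def tangentBasis (x : M) :
    Basis (Fin (finrank ℝ E)) ℝ (TangentSpace 𝓘(ℝ, E) x) :=
  Module.finBasis ℝ E

/-- The Ricci tensor `S(u,w) = trace (z ↦ R(z,u)w)`. By tensoriality the curvature may be evaluated
on any smooth local extensions of the vectors; `extend` has constant components in a chart. -/
noncomputable def ricci (g : LorentzianMetric E M) (x : M) (u w : TangentSpace 𝓘(ℝ, E) x) : ℝ :=
  ∑ i, (tangentBasis x).coord i
    (g.curvature (extend E (tangentBasis x i)) (extend E u) (extend E w) x)

/-- The matrix `g_{ij}` of the metric at `x`. -/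
noncomputable def gram (g : LorentzianMetric E M) (x : M) :
    Matrix (Fin (finrank ℝ E)) (Fin (finrank ℝ E)) ℝ :=
  Matrix.of fun i j ↦ g.val x (tangentBasis x i) (tangentBasis x j)

/-- The scalar curvature `r = g^{ij} S_{ij}`, the metric trace of the Ricci tensor. -/
noncomputable def scalarCurvature (g : LorentzianMetric E M) (x : M) : ℝ :=
  ∑ i, ∑ j, (g.gram x)⁻¹ i j * g.ricci x (tangentBasis x i) (tangentBasis x j)

/-- The Hessian `(∇∇v)(u,w) = u(W v) - (∇_u W) v`, for any smooth local extension `W` of `w`. -/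
noncomputable def hessian (g : LorentzianMetric E M) (v : M → ℝ) (x : M)
    (u w : TangentSpace 𝓘(ℝ, E) x) : ℝ :=
  mvfderiv 𝓘(ℝ, E) (fun y ↦ mvfderiv 𝓘(ℝ, E) v y (extend E w y)) x u
    - mvfderiv 𝓘(ℝ, E) v x (g.leviCivita (extend E w) x u)

/-- `g` is a gradient Ricci-Yamabe soliton with potential function `v`:
`Hess v + σ S + (Λ - ρ r / 2) g = 0`. -/
structure IsGradientRicciYamabeSoliton (g : LorentzianMetric E M) (v : M → ℝ) (σ ρ Λ : ℝ) :
    Prop where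
  contMDiff : ContMDiff 𝓘(ℝ, E) 𝓘(ℝ) ∞ v
  eq_zero : ∀ (x : M) (u w : TangentSpace 𝓘(ℝ, E) x),
    g.hessian v x u w + σ * g.ricci x u w + (Λ - ρ * g.scalarCurvature x / 2) * g.val x u w = 0

end

end LorentzianMetric

/-- A Lorentzian almost paracontact metric structure `(φ, ζ, ν, g)`. -/
structure LorentzianAlmostParacontact (E : Type*) [NormedAddCommGroup E] [NormedSpace ℝ E]
    (M : Type*) [TopologicalSpace M] [ChartedSpace E M] [IsManifold 𝓘(ℝ, E) ∞ M] where
  g : LorentzianMetric E M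
  φ : ∀ x : M, TangentSpace 𝓘(ℝ, E) x →L[ℝ] TangentSpace 𝓘(ℝ, E) x
  ζ : ∀ x : M, TangentSpace 𝓘(ℝ, E) x
  ν : ∀ x : M, TangentSpace 𝓘(ℝ, E) x →L[ℝ] ℝ
  contMDiff_φ : ContMDiff 𝓘(ℝ, E) (𝓘(ℝ, E).prod 𝓘(ℝ, E →L[ℝ] E)) ∞
    (fun x ↦ TotalSpace.mk' (E →L[ℝ] E)
      (E := fun x : M ↦ TangentSpace 𝓘(ℝ, E) x →L[ℝ] TangentSpace 𝓘(ℝ, E) x) x (φ x))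
  contMDiff_ζ : ContMDiff 𝓘(ℝ, E) (𝓘(ℝ, E).prod 𝓘(ℝ, E)) ∞
    (fun x ↦ TotalSpace.mk' E (E := fun x : M ↦ TangentSpace 𝓘(ℝ, E) x) x (ζ x))
  contMDiff_ν : ContMDiff 𝓘(ℝ, E) (𝓘(ℝ, E).prod 𝓘(ℝ, E →L[ℝ] ℝ)) ∞
    (fun x ↦ TotalSpace.mk' (E →L[ℝ] ℝ)
      (E := fun x : M ↦ TangentSpace 𝓘(ℝ, E) x →L[ℝ] ℝ) x (ν x))
  ν_ζ : ∀ x, ν x (ζ x) + 1 = 0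
  φ_φ : ∀ x u, φ x (φ x u) = u + ν x u • ζ x
  φ_ζ : ∀ x, φ x (ζ x) = 0
  ν_φ : ∀ x u, ν x (φ x u) = 0
  g_φ_φ : ∀ x u w, g.val x (φ x u) (φ x w) = g.val x u w + ν x u * ν x w
  g_ζ : ∀ x u, g.val x u (ζ x) = ν x u
  g_φ_symm : ∀ x u w, g.val x u (φ x w) = g.val x w (φ x u)

/-- The structure is Lorentzian para-Kenmotsu:
`(∇_u φ)F = -g(φu, F) ζ - ν(F) φu`, where `(∇_u φ)F = ∇_u (φF) - φ(∇_u F)`. -/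
def LorentzianAlmostParacontact.IsLPKenmotsu {E : Type*} [NormedAddCommGroup E] [NormedSpace ℝ E]
    [FiniteDimensional ℝ E] {M : Type*} [TopologicalSpace M] [ChartedSpace E M]
    [IsManifold 𝓘(ℝ, E) ∞ M] (P : LorentzianAlmostParacontact E M) : Prop :=
  ∀ (x : M) (u : TangentSpace 𝓘(ℝ, E) x) (F : ∀ x : M, TangentSpace 𝓘(ℝ, E) x),
    MDiffAt (T% F) x →
      P.g.leviCivita (fun y ↦ P.φ y (F y)) x u - P.φ x (P.g.leviCivita F x u) =
        -(P.g.val x (P.φ x u) (F x)) • P.ζ x - P.ν x (F x) • P.φ x u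

/-! Write n for the dimension, f = ζ(v), μ = Λ - ρr/2 and κ = σ(n-1) + μ. Since r is constant, μ and
κ are constants, and the soliton equation reads Hess v + σS + μg = 0.

The structure equation forces ∇_u ζ = -u - ν(u)ζ, hence ∇ν = -(g + ν⊗ν), R(u,w)ζ = ν(w)u - ν(u)w and
S(·,ζ) = (n-1)ν. Putting ζ in one slot of the soliton equation gives df + dv = -(f+κ)ν. The left
side is exact and ν is closed, so df∧ν = 0; evaluation at ζ then yields df = -κν and dv = -fν
(`mvfderiv_of_hessian`). Differentiating dv makes the Hessian explicit, so σS = -μg - κ ν⊗ν - f(g +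
ν⊗ν).

The second ingredient is ∇_ζ S = 2S - 2(n-1)g (`mvfderiv_ricci_ζ`), the trace of the formula for ∇_ζ
R in `nabla_curvature_ζ`, which comes from the second Bianchi identity. Both g and ν are parallel
along ζ, so applying ∇_ζ to the expression for σS gives (κ + 2f)(g + ν⊗ν) = 0. As n ≥ 2, the tensor
g + ν⊗ν does not vanish, so f = -κ/2 is constant; then κ = df(ζ) = 0, f = 0 and dv = 0. There is no
division by σ, so σ = 0 needs no separate case.

The rest is semi-Riemannian calculus: smoothness of ∇, tensoriality and symmetries of the curvature,
both Bianchi identities, and the derivative of a trace. Iterated covariant derivatives need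
smoothness on a neighbourhood, so the calculus is set up for fields smooth near a point. -/

open Filter Topology

set_option linter.unusedSectionVars false

/-! ### Fields and functions smooth near a point. -/

section SmoothNear

variable {E : Type*} [NormedAddCommGroup E] [NormedSpace ℝ E]
  {M : Type*} [TopologicalSpace M] [ChartedSpace E M] [IsManifold 𝓘(ℝ, E) ∞ M]

/-- The vector field `X` is smooth in a neighbourhood of `x`. -/
def SmoothNear (X : ∀ x : M, TangentSpace 𝓘(ℝ, E) x) (x : M) : Prop :=
  ∀ᶠ y in 𝓝 x, CMDiffAt ∞ (T% X) y

/-- The function `f` is smooth in a neighbourhood of `x`. -/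
def SmoothFunNear (E : Type*) [NormedAddCommGroup E] [NormedSpace ℝ E]
    {M : Type*} [TopologicalSpace M] [ChartedSpace E M] (f : M → ℝ) (x : M) : Prop :=
  ∀ᶠ y in 𝓝 x, ContMDiffAt 𝓘(ℝ, E) 𝓘(ℝ) ∞ f y

variable {X Y Z : ∀ x : M, TangentSpace 𝓘(ℝ, E) x} {f k : M → ℝ} {x : M}

theorem SmoothNear.contMDiffAt (h : SmoothNear X x) : CMDiffAt ∞ (T% X) x := h.self_of_nhds

theorem SmoothNear.eventually (h : SmoothNear X x) : ∀ᶠ y in 𝓝 x, SmoothNear X y :=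
  eventually_eventually_nhds.mpr h

theorem SmoothNear.mdiff (h : SmoothNear X x) : MDiffAt (T% X) x :=
  h.contMDiffAt.mdifferentiableAt (by simp)

theorem SmoothFunNear.contMDiffAt (h : SmoothFunNear E f x) :
    ContMDiffAt 𝓘(ℝ, E) 𝓘(ℝ) ∞ f x := h.self_of_nhds

theorem SmoothFunNear.eventually (h : SmoothFunNear E f x) :
    ∀ᶠ y in 𝓝 x, SmoothFunNear E f y :=
  eventually_eventually_nhds.mpr h

theorem SmoothFunNear.mdiff (h : SmoothFunNear E f x) : MDifferentiableAt 𝓘(ℝ, E) 𝓘(ℝ) f x :=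
  h.contMDiffAt.mdifferentiableAt (by simp)

theorem SmoothNear.congr (h : SmoothNear X x) (e : X =ᶠ[𝓝 x] Y) : SmoothNear Y x := by
  filter_upwards [h, eventually_eventually_nhds.mpr e] with y hy ey
  refine hy.congr_of_eventuallyEq ?_
  filter_upwards [ey] with z hz
  rw [hz]

theorem SmoothFunNear.congr (h : SmoothFunNear E f x) (e : f =ᶠ[𝓝 x] k) : SmoothFunNear E k x := by
  filter_upwards [h, eventually_eventually_nhds.mpr e] with y hy ey
  refine hy.congr_of_eventuallyEq ?_
  filter_upwards [ey] with z hz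
  rw [hz]

theorem SmoothNear.add (hX : SmoothNear X x) (hY : SmoothNear Y x) : SmoothNear (X + Y) x := by
  filter_upwards [hX, hY] with y h1 h2 using h1.add_section h2

theorem SmoothNear.sub (hX : SmoothNear X x) (hY : SmoothNear Y x) : SmoothNear (X - Y) x := by
  filter_upwards [hX, hY] with y h1 h2 using h1.sub_section h2

theorem SmoothNear.neg (hX : SmoothNear X x) : SmoothNear (-X) x := by
  filter_upwards [hX] with y h1 using h1.neg_section

theorem SmoothFunNear.smul (hf : SmoothFunNear E f x) (hX : SmoothNear X x) :
    SmoothNear (f • X) x := by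
  filter_upwards [hf, hX] with y h1 h2 using h1.smul_section h2

theorem SmoothNear.sum {ι : Type*} [Fintype ι] {X : ι → ∀ x : M, TangentSpace 𝓘(ℝ, E) x}
    (h : ∀ i, SmoothNear (X i) x) : SmoothNear (fun y ↦ ∑ i, X i y) x := by
  filter_upwards [eventually_all.mpr h] with y hy
  exact ContMDiffAt.sum_section fun i _ ↦ hy i

theorem SmoothFunNear.add (hf : SmoothFunNear E f x) (hk : SmoothFunNear E k x) :
    SmoothFunNear E (f + k) x := by
  filter_upwards [hf, hk] with y h1 h2 using h1.add h2

theorem SmoothFunNear.sub (hf : SmoothFunNear E f x) (hk : SmoothFunNear E k x) :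
    SmoothFunNear E (f - k) x := by
  filter_upwards [hf, hk] with y h1 h2 using h1.sub h2

theorem SmoothFunNear.mul (hf : SmoothFunNear E f x) (hk : SmoothFunNear E k x) :
    SmoothFunNear E (f * k) x := by
  filter_upwards [hf, hk] with y h1 h2 using h1.mul h2

theorem SmoothFunNear.const (c : ℝ) : SmoothFunNear E (fun _ : M ↦ c) x :=
  Eventually.of_forall fun _ ↦ contMDiffAt_const

theorem smoothNear_extend (u : TangentSpace 𝓘(ℝ, E) x) : SmoothNear (extend E u) x := by
  obtain ⟨s, hs, h⟩ := exists_contMDiffOn_extend (k := ∞) 𝓘(ℝ, E) E u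
  filter_upwards [eventually_eventually_nhds.mpr hs] with y hy
  exact h.contMDiffAt hy

theorem SmoothNear.bracket [CompleteSpace E] (hX : SmoothNear X x) (hY : SmoothNear Y x) :
    SmoothNear (mlieBracket 𝓘(ℝ, E) X Y) x := by
  have : IsManifold 𝓘(ℝ, E) (minSmoothness ℝ 2) M := by
    simp only [minSmoothness_of_isRCLikeNormedField]
    exact IsManifold.of_le (n := ∞) (by norm_cast)
  have : IsManifold 𝓘(ℝ, E) (((⊤ : ℕ∞) : WithTop ℕ∞) + 1) M := by
    simpa using (inferInstance : IsManifold 𝓘(ℝ, E) ∞ M)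
  filter_upwards [hX, hY] with y h1 h2
  exact ContMDiffAt.mlieBracket_vectorField (m := ⊤) (n := ⊤) h1 h2 (by simp)

theorem SmoothFunNear.dir (hf : SmoothFunNear E f x) (hX : SmoothNear X x) :
    SmoothFunNear E (fun y ↦ mvfderiv 𝓘(ℝ, E) f y (X y)) x := by
  filter_upwards [hf, hX] with y h1 h2
  have h3 : ContMDiffAt 𝓘(ℝ, E) 𝓘(ℝ).tangent ∞
      (fun m ↦ TotalSpace.mk' ℝ (E := fun z : ℝ ↦ TangentSpace 𝓘(ℝ) z) (f m)
        (mfderiv 𝓘(ℝ, E) 𝓘(ℝ) f m (X m))) y :=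
    ContMDiffAt.clm_apply_of_inCoordinates (h1.mfderiv_const (m := ∞) (by simp)) h2 h1
  have h4 := (contMDiffAt_totalSpace.mp h3).2
  simp only [trivializationAt_model_space_apply] at h4
  exact h4

theorem SmoothNear.metric (g : LorentzianMetric E M) (hX : SmoothNear X x) (hY : SmoothNear Y x) :
    SmoothFunNear E (fun y ↦ g.val y (X y) (Y y)) x := by
  filter_upwards [hX, hY] with y h1 h2
  have : ContMDiffAt 𝓘(ℝ, E) (𝓘(ℝ, E).prod 𝓘(ℝ)) ∞
      (fun m ↦ TotalSpace.mk' ℝ (E := Bundle.Trivial M ℝ) m (g.val m (X m) (Y m))) y := by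
    apply ContMDiffAt.clm_bundle_apply₂ (F₁ := E) (F₂ := E)
    · exact g.contMDiff y
    · exact h1
    · exact h2
  exact (contMDiffAt_totalSpace.mp this).2

end SmoothNear

/-! ### Local frames, and smoothness of the Levi-Civita connection. -/

section Frame

variable {E : Type*} [NormedAddCommGroup E] [NormedSpace ℝ E] [FiniteDimensional ℝ E]
  {M : Type*} [TopologicalSpace M] [ChartedSpace E M] [IsManifold 𝓘(ℝ, E) ∞ M]
  {X Y Z : ∀ x : M, TangentSpace 𝓘(ℝ, E) x} {f k : M → ℝ} {x y : M}

/-- The coordinate frame around `x` given by the preferred trivialization at `x`. -/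
noncomputable def coordFrame (x : M) (i : Fin (finrank ℝ E)) : ∀ y : M, TangentSpace 𝓘(ℝ, E) y :=
  (trivializationAt E (TangentSpace 𝓘(ℝ, E)) x).localFrame (finBasis ℝ E) i

/-- The coefficients with respect to `coordFrame`. -/
noncomputable def frameCoeff (x : M) (i : Fin (finrank ℝ E)) (y : M) :
    TangentSpace 𝓘(ℝ, E) y →ₗ[ℝ] ℝ :=
  (trivializationAt E (TangentSpace 𝓘(ℝ, E)) x).localFrameCoeff 𝓘(ℝ, E) (finBasis ℝ E) i y

/-- The domain of `coordFrame`. -/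
def frameSet (E : Type*) [NormedAddCommGroup E] [NormedSpace ℝ E]
    {M : Type*} [TopologicalSpace M] [ChartedSpace E M] [IsManifold 𝓘(ℝ, E) ∞ M] (x : M) : Set M :=
  (trivializationAt E (TangentSpace 𝓘(ℝ, E) : M → Type _) x).baseSet

theorem mem_frameSet_self (x : M) : x ∈ frameSet E x :=
  FiberBundle.mem_baseSet_trivializationAt' x

theorem isOpen_frameSet (x : M) : IsOpen (frameSet E x) :=
  (trivializationAt E (TangentSpace 𝓘(ℝ, E) : M → Type _) x).open_baseSet

theorem eventually_mem_frameSet (hy : y ∈ frameSet E x) : ∀ᶠ z in 𝓝 y, z ∈ frameSet E x :=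
  (isOpen_frameSet x).mem_nhds hy

theorem smoothNear_coordFrame (hy : y ∈ frameSet E x) (i : Fin (finrank ℝ E)) :
    SmoothNear (coordFrame x i) y := by
  filter_upwards [eventually_mem_frameSet hy] with z hz
  exact contMDiffAt_localFrame_of_mem ∞ _ (finBasis ℝ E) i hz

theorem sum_frameCoeff_smul (hy : y ∈ frameSet E x) (v : TangentSpace 𝓘(ℝ, E) y) :
    ∑ i, frameCoeff x i y v • coordFrame x i y = v := by
  have := (trivializationAt E (TangentSpace 𝓘(ℝ, E)) x).eq_sum_localFrameCoeff_smul
    (I := 𝓘(ℝ, E)) (b := finBasis ℝ E) (s := extend E v) hy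
  simpa [frameCoeff, coordFrame] using this.symm

theorem frameCoeff_coordFrame (hy : y ∈ frameSet E x) (i j : Fin (finrank ℝ E)) :
    frameCoeff x i y (coordFrame x j y) = if i = j then 1 else 0 := by
  have := (trivializationAt E (TangentSpace 𝓘(ℝ, E)) x).localFrameCoeff_apply_of_mem_baseSet
    (I := 𝓘(ℝ, E)) (finBasis ℝ E) hy (coordFrame x j) i
  rw [frameCoeff, this, coordFrame, Bundle.Trivialization.localFrame_apply_of_mem_baseSet _ _ hy]
  simp [Finsupp.single_apply, eq_comm]

theorem SmoothNear.frameCoeff (hX : SmoothNear X y) (hy : y ∈ frameSet E x)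
    (i : Fin (finrank ℝ E)) : SmoothFunNear E (fun z ↦ frameCoeff x i z (X z)) y := by
  filter_upwards [eventually_mem_frameSet hy, hX] with z hz hXz
  exact contMDiffAt_localFrameCoeff (finBasis ℝ E) hz hXz i

theorem eventuallyEq_sum_frameCoeff (X : ∀ x : M, TangentSpace 𝓘(ℝ, E) x)
    (hy : y ∈ frameSet E x) :
    (fun z ↦ ∑ i, (((fun z ↦ _root_.frameCoeff x i z (X z)) • coordFrame x i :
      ∀ z : M, TangentSpace 𝓘(ℝ, E) z)) z) =ᶠ[𝓝 y] X := by
  filter_upwards [eventually_mem_frameSet hy] with z hz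
  exact sum_frameCoeff_smul hz (X z)

theorem smoothNear_of_frameCoeff (hy : y ∈ frameSet E x)
    (h : ∀ i, SmoothFunNear E (fun z ↦ frameCoeff x i z (X z)) y) : SmoothNear X y :=
  (SmoothNear.sum fun i ↦ SmoothFunNear.smul (h i) (smoothNear_coordFrame hy i)).congr
    (eventuallyEq_sum_frameCoeff X hy)

/-- The basis of `T_y M` given by `coordFrame x`. -/
noncomputable def frameBasis (hy : y ∈ frameSet E x) :
    Basis (Fin (finrank ℝ E)) ℝ (TangentSpace 𝓘(ℝ, E) y) :=
  (trivializationAt E (TangentSpace 𝓘(ℝ, E)) x).basisAt (finBasis ℝ E) hy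

theorem frameBasis_apply (hy : y ∈ frameSet E x) (i : Fin (finrank ℝ E)) :
    frameBasis hy i = coordFrame x i y := by
  rw [coordFrame, Bundle.Trivialization.localFrame_apply_of_mem_baseSet _ _ hy]
  rfl

theorem frameBasis_repr (hy : y ∈ frameSet E x) (v : TangentSpace 𝓘(ℝ, E) y)
    (i : Fin (finrank ℝ E)) : (frameBasis hy).repr v i = frameCoeff x i y v := by
  conv_lhs => rw [← sum_frameCoeff_smul hy v]
  simp [← frameBasis_apply hy, Finsupp.single_apply]

theorem SmoothFunNear.sum {ι : Type*} (s : Finset ι) {f : ι → M → ℝ}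
    (h : ∀ i ∈ s, SmoothFunNear E (f i) x) : SmoothFunNear E (fun y ↦ ∑ i ∈ s, f i y) x := by
  classical
  induction s using Finset.induction_on with
  | empty => simpa using SmoothFunNear.const 0
  | insert a s ha ih =>
    simp only [Finset.sum_insert ha]
    exact (h a (by simp)).add (ih fun i hi ↦ h i (by simp [hi]))

theorem SmoothFunNear.prod {ι : Type*} (s : Finset ι) {f : ι → M → ℝ}
    (h : ∀ i ∈ s, SmoothFunNear E (f i) x) : SmoothFunNear E (fun y ↦ ∏ i ∈ s, f i y) x := by
  classical
  induction s using Finset.induction_on with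
  | empty => simpa using SmoothFunNear.const 1
  | insert a s ha ih =>
    simp only [Finset.prod_insert ha]
    exact (h a (by simp)).mul (ih fun i hi ↦ h i (by simp [hi]))

theorem SmoothFunNear.det {ι : Type*} [Fintype ι] [DecidableEq ι] {A : M → Matrix ι ι ℝ}
    (h : ∀ i j, SmoothFunNear E (fun y ↦ A y i j) x) : SmoothFunNear E (fun y ↦ (A y).det) x := by
  simp only [Matrix.det_apply']
  exact SmoothFunNear.sum _ fun σ _ ↦
    (SmoothFunNear.const _).mul (SmoothFunNear.prod _ fun i _ ↦ h _ _)

theorem SmoothFunNear.div (hf : SmoothFunNear E f x) (hk : SmoothFunNear E k x)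
    (h0 : ∀ᶠ y in 𝓝 x, k y ≠ 0) : SmoothFunNear E (fun y ↦ f y / k y) x := by
  filter_upwards [hf, hk, h0] with y h1 h2 h3 using h1.div₀ h2 h3

namespace LorentzianMetric

variable (g : LorentzianMetric E M)

/-- A vector field is smooth as soon as its inner products with a smooth frame are. -/
theorem smoothNear_of_inner (hy : y ∈ frameSet E x)
    (h : ∀ i, SmoothFunNear E (fun z ↦ g.val z (coordFrame x i z) (X z)) y) : SmoothNear X y := by
  let G : M → Matrix (Fin (finrank ℝ E)) (Fin (finrank ℝ E)) ℝ := fun z ↦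
    Matrix.of fun i j ↦ g.val z (coordFrame x i z) (coordFrame x j z)
  let c : M → Fin (finrank ℝ E) → ℝ := fun z i ↦ frameCoeff x i z (X z)
  have hG : ∀ i j, SmoothFunNear E (fun z ↦ G z i j) y := fun i j ↦
    SmoothNear.metric g (smoothNear_coordFrame hy i) (smoothNear_coordFrame hy j)
  have hmul : ∀ z ∈ frameSet E x, ∀ a : Fin (finrank ℝ E) → ℝ, ∀ i,
      (G z).mulVec a i = g.val z (coordFrame x i z) (∑ j, a j • coordFrame x j z) := by
    intro z hz a i
    simp [G, Matrix.mulVec, dotProduct, mul_comm]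
  -- The Gram matrix is invertible: a kernel vector gives a tangent vector orthogonal to the whole
  -- frame, hence zero by nondegeneracy.
  have hdet : ∀ᶠ z in 𝓝 y, (G z).det ≠ 0 := by
    filter_upwards [eventually_mem_frameSet hy] with z hz h0
    obtain ⟨a, ha, h1⟩ := Matrix.exists_mulVec_eq_zero_iff.mpr h0
    have h2 : ∑ j, a j • coordFrame x j z = 0 := by
      refine g.eq_zero_of_forall fun w ↦ ?_
      rw [g.symm, ← sum_frameCoeff_smul hz w, map_sum (g.val z), sum_apply]
      refine Finset.sum_eq_zero fun i _ ↦ ?_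
      rw [map_smul, smul_apply, ← hmul z hz a i, h1]
      simp
    refine ha (funext fun i ↦ ?_)
    have := congrArg (frameCoeff x i z) h2
    simpa [frameCoeff_coordFrame hz] using this
  refine smoothNear_of_frameCoeff hy fun i ↦ ?_
  -- Cramer's rule writes each frame coefficient of `X` as a quotient of determinants of smooth
  -- functions.
  have key : SmoothFunNear E (fun z ↦
      ((G z).updateCol i fun i ↦ g.val z (coordFrame x i z) (X z)).det / (G z).det) y := by
    refine SmoothFunNear.div (SmoothFunNear.det fun k l ↦ ?_) (SmoothFunNear.det hG) hdet
    by_cases hl : l = i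
    · subst hl
      simpa using h k
    · simpa [Matrix.updateCol_apply, hl] using hG k l
  refine key.congr ?_
  filter_upwards [eventually_mem_frameSet hy, hdet] with z hz h0
  have h1 : (fun i ↦ g.val z (coordFrame x i z) (X z)) = (G z).mulVec (c z) := by
    funext i
    rw [hmul z hz, sum_frameCoeff_smul hz]
  rw [h1, ← Matrix.cramer_apply, Matrix.cramer_eq_adjugate_mulVec, Matrix.mulVec_mulVec,
    Matrix.adjugate_mul, Matrix.smul_mulVec, Matrix.one_mulVec]
  simp [c, h0]

/-- The vector field `∇_X Y`. -/
noncomputable def nabla (X Y : ∀ x : M, TangentSpace 𝓘(ℝ, E) x) :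
    ∀ x : M, TangentSpace 𝓘(ℝ, E) x :=
  fun x ↦ g.leviCivita Y x (X x)

/-- The Koszul formula, from the two defining properties of the connection: metric compatibility
rewrites the three derivatives, and vanishing torsion the three brackets. -/
theorem two_mul_nabla (hX : MDiffAt (T% X) x) (hY : MDiffAt (T% Y) x) (hZ : MDiffAt (T% Z) x) :
    2 * g.val x (g.nabla X Y x) (Z x) = g.koszul X Y Z x := by
  have hc := g.isLeviCivita_leviCivita
  have m1 := hc.metric x (X x) _ _ hY hZ
  have m2 := hc.metric x (Y x) _ _ hX hZ
  have m3 := hc.metric x (Z x) _ _ hX hY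
  simp only [nabla, koszul, ← hc.torsion_free x _ _ hX hY, ← hc.torsion_free x _ _ hX hZ,
    ← hc.torsion_free x _ _ hY hZ, map_sub, sub_apply] at m1 m2 m3 ⊢
  rw [m1, m2, m3, g.symm x (Y x), g.symm x (X x), g.symm x (X x)]
  ring

end LorentzianMetric

theorem SmoothNear.koszul (g : LorentzianMetric E M) (hX : SmoothNear X x) (hY : SmoothNear Y x)
    (hZ : SmoothNear Z x) : SmoothFunNear E (g.koszul X Y Z) x := by
  have := FiniteDimensional.complete ℝ E
  have h1 := (hY.metric g hZ).dir hX
  have h2 := (hX.metric g hZ).dir hY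
  have h3 := (hX.metric g hY).dir hZ
  have h4 := (hX.bracket hY).metric g hZ
  have h5 := (hX.bracket hZ).metric g hY
  have h6 := (hY.bracket hZ).metric g hX
  exact ((((h1.add h2).sub h3).add h4).sub h5).sub h6

/-- The connection is obtained by choice, and being Levi-Civita says nothing about smoothness. The
Koszul formula supplies it: the inner products of ∇_X Y with a smooth frame are smooth. -/
theorem SmoothNear.nabla (g : LorentzianMetric E M) (hX : SmoothNear X x) (hY : SmoothNear Y x) :
    SmoothNear (g.nabla X Y) x := by
  refine g.smoothNear_of_inner (mem_frameSet_self x) fun i ↦ ?_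
  have h := (SmoothFunNear.const (E := E) (x := x) (1 / 2)).mul
    (hX.koszul g hY (smoothNear_coordFrame (mem_frameSet_self x) i))
  refine h.congr ?_
  filter_upwards [hX.eventually, hY.eventually,
    (smoothNear_coordFrame (mem_frameSet_self x) i).eventually] with z h1 h2 h3
  rw [g.symm]
  have := g.two_mul_nabla h1.mdiff h2.mdiff h3.mdiff
  simp only [Pi.mul_apply]
  linarith

end Frame

/-! ### The curvature operator and its tensoriality. -/

section Curvature

variable {E : Type*} [NormedAddCommGroup E] [NormedSpace ℝ E] [FiniteDimensional ℝ E]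
  {M : Type*} [TopologicalSpace M] [ChartedSpace E M] [IsManifold 𝓘(ℝ, E) ∞ M]
  {X Y Z W X' Y' Z' : ∀ x : M, TangentSpace 𝓘(ℝ, E) x} {f k : M → ℝ} {x y : M}

theorem mvfderiv_congr (h : f =ᶠ[𝓝 x] k) : mvfderiv 𝓘(ℝ, E) f x = mvfderiv 𝓘(ℝ, E) k x := by
  have h1 := h.mfderiv_eq (I := 𝓘(ℝ, E)) (I' := 𝓘(ℝ))
  ext u
  exact congrArg (fun L : E →L[ℝ] ℝ ↦ L u) h1

theorem mlieBracket_jacobi (hX : SmoothNear X x) (hY : SmoothNear Y x) (hZ : SmoothNear Z x) :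
    mlieBracket 𝓘(ℝ, E) X (mlieBracket 𝓘(ℝ, E) Y Z) x =
      mlieBracket 𝓘(ℝ, E) (mlieBracket 𝓘(ℝ, E) X Y) Z x +
        mlieBracket 𝓘(ℝ, E) Y (mlieBracket 𝓘(ℝ, E) X Z) x := by
  have := FiniteDimensional.complete ℝ E
  have h2 : minSmoothness ℝ 2 ≤ ∞ := by
    simp only [minSmoothness_of_isRCLikeNormedField]
    norm_cast
  have : IsManifold 𝓘(ℝ, E) (minSmoothness ℝ 3) M := by
    simp only [minSmoothness_of_isRCLikeNormedField]
    exact IsManifold.of_le (n := ∞) (by norm_cast)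
  exact leibniz_identity_mlieBracket_apply (hX.contMDiffAt.of_le h2) (hY.contMDiffAt.of_le h2)
    (hZ.contMDiffAt.of_le h2)

/-- The Lie bracket acts on functions as the commutator of derivations. -/
theorem mvfderiv_mlieBracket (hf : SmoothFunNear E f x) (hX : SmoothNear X x)
    (hY : SmoothNear Y x) :
    mvfderiv 𝓘(ℝ, E) f x (mlieBracket 𝓘(ℝ, E) X Y x) =
      mvfderiv 𝓘(ℝ, E) (fun y ↦ mvfderiv 𝓘(ℝ, E) f y (Y y)) x (X x)
        - mvfderiv 𝓘(ℝ, E) (fun y ↦ mvfderiv 𝓘(ℝ, E) f y (X y)) x (Y x) := by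
  have := FiniteDimensional.complete ℝ E
  -- A nonzero tangent vector is needed to read off a scalar coefficient below; in a zero tangent
  -- space both sides vanish.
  by_cases hv : ∃ v : TangentSpace 𝓘(ℝ, E) x, v ≠ 0
  swap
  · push Not at hv
    rw [hv (mlieBracket 𝓘(ℝ, E) X Y x), hv (X x), hv (Y x)]
    simp
  obtain ⟨v, hv⟩ := hv
  set Z : ∀ x : M, TangentSpace 𝓘(ℝ, E) x := extend E v
  have hZ : SmoothNear Z x := smoothNear_extend v
  have hstep : ∀ {Y : ∀ x : M, TangentSpace 𝓘(ℝ, E) x}, SmoothNear Y x →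
      mlieBracket 𝓘(ℝ, E) Y (f • Z) =ᶠ[𝓝 x]
        (fun y ↦ mvfderiv 𝓘(ℝ, E) f y (Y y)) • Z + f • mlieBracket 𝓘(ℝ, E) Y Z := by
    intro Y hY
    filter_upwards [hf.eventually, hZ.eventually] with y h1 h2
    rw [mlieBracket_smul_right h1.mdiff h2.mdiff]
    rfl
  have hdouble : ∀ {X Y : ∀ x : M, TangentSpace 𝓘(ℝ, E) x}, SmoothNear X x → SmoothNear Y x →
      mlieBracket 𝓘(ℝ, E) X (mlieBracket 𝓘(ℝ, E) Y (f • Z)) x =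
        mvfderiv 𝓘(ℝ, E) (fun y ↦ mvfderiv 𝓘(ℝ, E) f y (Y y)) x (X x) • Z x
          + mvfderiv 𝓘(ℝ, E) f x (Y x) • mlieBracket 𝓘(ℝ, E) X Z x
          + mvfderiv 𝓘(ℝ, E) f x (X x) • mlieBracket 𝓘(ℝ, E) Y Z x
          + f x • mlieBracket 𝓘(ℝ, E) X (mlieBracket 𝓘(ℝ, E) Y Z) x := by
    intro X Y hX hY
    rw [Filter.EventuallyEq.mlieBracket_vectorField_eq (EventuallyEq.refl _ X) (hstep hY),
      mlieBracket_add_right ((hf.dir hY).smul hZ).mdiff (hf.smul (hY.bracket hZ)).mdiff,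
      mlieBracket_smul_right (hf.dir hY).mdiff hZ.mdiff,
      mlieBracket_smul_right hf.mdiff (hY.bracket hZ).mdiff]
    abel
  -- Expand the Jacobi identity for X, Y, fZ by the Leibniz rule and subtract f times the one for X,
  -- Y, Z. The first-order terms in f cancel, leaving a multiple of Z whose coefficient is the
  -- difference of the two sides.
  have h := mlieBracket_jacobi hX hY (hf.smul hZ)
  rw [hdouble hX hY, hdouble hY hX, mlieBracket_smul_right hf.mdiff hZ.mdiff,
    mlieBracket_jacobi hX hY hZ] at h
  have hZx : Z x = v := extend_apply_self E v
  have h' : (mvfderiv 𝓘(ℝ, E) f x (mlieBracket 𝓘(ℝ, E) X Y x) -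
      (mvfderiv 𝓘(ℝ, E) (fun y ↦ mvfderiv 𝓘(ℝ, E) f y (Y y)) x (X x)
        - mvfderiv 𝓘(ℝ, E) (fun y ↦ mvfderiv 𝓘(ℝ, E) f y (X y)) x (Y x))) • v = 0 := by
    rw [← hZx]
    rw [← sub_eq_zero.mpr h.symm]
    module
  rcases smul_eq_zero.mp h' with h0 | h0
  · linarith
  · exact absurd h0 hv

namespace LorentzianMetric

variable (g : LorentzianMetric E M)

theorem nabla_congr (hY : SmoothNear Y x) (h : Y =ᶠ[𝓝 x] Y') :
    g.nabla X Y x = g.nabla X Y' x := by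
  have := g.leviCivita.isCovariantDerivativeOn (s := Set.univ) |>.congr_of_eventuallyEq
    hY.mdiff (hY.congr h).mdiff univ_mem h
  simp only [nabla, this]

theorem nabla_add (hY : SmoothNear Y x) (hY' : SmoothNear Y' x) :
    g.nabla X (Y + Y') x = g.nabla X Y x + g.nabla X Y' x := by
  have := g.leviCivita.isCovariantDerivativeOnUniv.add hY.mdiff hY'.mdiff
  simp only [nabla, this, add_apply]

theorem nabla_smul (hf : SmoothFunNear E f x) (hY : SmoothNear Y x) :
    g.nabla X (f • Y) x = f x • g.nabla X Y x + mvfderiv 𝓘(ℝ, E) f x (X x) • Y x := by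
  have := g.leviCivita.isCovariantDerivativeOnUniv.leibniz hY.mdiff hf.mdiff
  simp only [nabla, this, add_apply, smul_apply, ContinuousLinearMap.smulRight_apply]

theorem nabla_sub (hY : SmoothNear Y x) (hY' : SmoothNear Y' x) :
    g.nabla X (Y - Y') x = g.nabla X Y x - g.nabla X Y' x := by
  have h := g.nabla_add (X := X) (hY.sub hY') hY'
  rw [sub_add_cancel] at h
  rw [h, add_sub_cancel_right]

theorem nabla_neg (hY : SmoothNear Y x) : g.nabla X (-Y) x = -g.nabla X Y x := by
  have h := g.nabla_smul (X := X) (f := fun _ ↦ (-1 : ℝ)) (SmoothFunNear.const (-1)) hY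
  rw [mvfderiv_const] at h
  simp only [Pi.smul_def', neg_smul, one_smul, zero_apply, zero_smul, add_zero] at h
  exact h

theorem mlieBracket_eq (hX : SmoothNear X x) (hY : SmoothNear Y x) :
    mlieBracket 𝓘(ℝ, E) X Y x = g.nabla X Y x - g.nabla Y X x :=
  (g.isLeviCivita_leviCivita.torsion_free x X Y hX.mdiff hY.mdiff).symm

theorem mvfderiv_inner (hX : SmoothNear X x) (hY : SmoothNear Y x) :
    mvfderiv 𝓘(ℝ, E) (fun y ↦ g.val y (X y) (Y y)) x (Z x) =
      g.val x (g.nabla Z X x) (Y x) + g.val x (X x) (g.nabla Z Y x) :=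
  g.isLeviCivita_leviCivita.metric x (Z x) X Y hX.mdiff hY.mdiff

theorem curvature_def : g.curvature X Y Z x = g.nabla X (g.nabla Y Z) x
    - g.nabla Y (g.nabla X Z) x - g.nabla (mlieBracket 𝓘(ℝ, E) X Y) Z x := rfl

theorem curvature_swap : g.curvature Y X Z x = -g.curvature X Y Z x := by
  simp only [curvature_def, nabla, mlieBracket_swap_apply (V := Y), map_neg]
  abel

theorem curvature_add_right (hX : SmoothNear X x) (hY : SmoothNear Y x) (hZ : SmoothNear Z x)
    (hZ' : SmoothNear Z' x) :
    g.curvature X Y (Z + Z') x = g.curvature X Y Z x + g.curvature X Y Z' x := by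
  have h : ∀ {Y : ∀ x : M, TangentSpace 𝓘(ℝ, E) x}, SmoothNear Y x →
      g.nabla Y (Z + Z') =ᶠ[𝓝 x] g.nabla Y Z + g.nabla Y Z' := fun hY ↦ by
    filter_upwards [hZ.eventually, hZ'.eventually] with y h1 h2
    exact g.nabla_add h1 h2
  simp only [curvature_def]
  rw [g.nabla_congr (hY.nabla g (hZ.add hZ')) (h hY), g.nabla_congr (hX.nabla g (hZ.add hZ')) (h hX),
    g.nabla_add (hY.nabla g hZ) (hY.nabla g hZ'), g.nabla_add (hX.nabla g hZ) (hX.nabla g hZ'),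
    g.nabla_add hZ hZ']
  abel

/-- The first-order terms in f cancel in the commutator, and the second-order ones, X(Yf) - Y(Xf),
cancel against the [X,Y]f coming from ∇_[X,Y]. -/
theorem curvature_smul_right (hf : SmoothFunNear E f x) (hX : SmoothNear X x)
    (hY : SmoothNear Y x) (hZ : SmoothNear Z x) :
    g.curvature X Y (f • Z) x = f x • g.curvature X Y Z x := by
  have h : ∀ {Y : ∀ x : M, TangentSpace 𝓘(ℝ, E) x}, SmoothNear Y x →
      g.nabla Y (f • Z) =ᶠ[𝓝 x]
        f • g.nabla Y Z + (fun y ↦ mvfderiv 𝓘(ℝ, E) f y (Y y)) • Z := fun hY ↦ by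
    filter_upwards [hZ.eventually, hf.eventually] with y h1 h2
    exact g.nabla_smul h2 h1
  simp only [curvature_def]
  rw [g.nabla_congr (hY.nabla g (hf.smul hZ)) (h hY), g.nabla_congr (hX.nabla g (hf.smul hZ)) (h hX),
    g.nabla_add (hf.smul (hY.nabla g hZ)) ((hf.dir hY).smul hZ),
    g.nabla_add (hf.smul (hX.nabla g hZ)) ((hf.dir hX).smul hZ),
    g.nabla_smul hf (hY.nabla g hZ), g.nabla_smul hf (hX.nabla g hZ),
    g.nabla_smul (hf.dir hY) hZ, g.nabla_smul (hf.dir hX) hZ,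
    g.nabla_smul hf hZ, mvfderiv_mlieBracket hf hX hY]
  module

theorem curvature_add_left (hX : SmoothNear X x) (hX' : SmoothNear X' x)
    (hZ : SmoothNear Z x) :
    g.curvature (X + X') Y Z x = g.curvature X Y Z x + g.curvature X' Y Z x := by
  have := FiniteDimensional.complete ℝ E
  have h : g.nabla (X + X') Z = g.nabla X Z + g.nabla X' Z := by
    ext y
    simp [nabla]
  simp only [curvature_def]
  rw [h, g.nabla_add (hX.nabla g hZ) (hX'.nabla g hZ)]
  simp only [nabla, mlieBracket_add_left hX.mdiff hX'.mdiff, Pi.add_apply, map_add]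
  abel

theorem curvature_smul_left (hf : SmoothFunNear E f x) (hX : SmoothNear X x) (hZ : SmoothNear Z x) :
    g.curvature (f • X) Y Z x = f x • g.curvature X Y Z x := by
  have := FiniteDimensional.complete ℝ E
  have h : g.nabla (f • X) Z = f • g.nabla X Z := by
    ext y
    simp [nabla]
  simp only [curvature_def]
  rw [h, g.nabla_smul hf (hX.nabla g hZ)]
  simp only [nabla, mlieBracket_smul_left hf.mdiff hX.mdiff, Pi.smul_apply', map_add, map_smul]
  module

theorem curvature_congr_right (hX : SmoothNear X x) (hY : SmoothNear Y x) (hZ : SmoothNear Z x)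
    (e : Z =ᶠ[𝓝 x] Z') : g.curvature X Y Z x = g.curvature X Y Z' x := by
  have h : ∀ {Y : ∀ x : M, TangentSpace 𝓘(ℝ, E) x}, g.nabla Y Z =ᶠ[𝓝 x] g.nabla Y Z' := by
    intro Y
    filter_upwards [hZ.eventually, eventually_eventually_nhds.mpr e] with y h1 h2
    exact g.nabla_congr h1 h2
  simp only [curvature_def]
  rw [g.nabla_congr (hY.nabla g hZ) h, g.nabla_congr (hX.nabla g hZ) h, g.nabla_congr hZ e]

theorem curvature_congr_left (hX : SmoothNear X x) (hZ : SmoothNear Z x)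
    (e : X =ᶠ[𝓝 x] X') : g.curvature X Y Z x = g.curvature X' Y Z x := by
  have h : g.nabla X Z =ᶠ[𝓝 x] g.nabla X' Z := by
    filter_upwards [e] with y h2
    simp only [nabla]
    rw [h2]
  simp only [curvature_def]
  rw [g.nabla_congr (hX.nabla g hZ) h]
  simp only [nabla, e.self_of_nhds,
    Filter.EventuallyEq.mlieBracket_vectorField_eq e (EventuallyEq.refl _ Y)]

end LorentzianMetric

/-- An additive, local, `C^∞`-linear operation on vector fields at `x` only depends on values
at `x`. -/
theorem eq_of_tensorial {A : Type*} [AddCommGroup A] [Module ℝ A]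
    (Φ : (∀ x : M, TangentSpace 𝓘(ℝ, E) x) → A)
    (hadd : ∀ X Y, SmoothNear X x → SmoothNear Y x → Φ (X + Y) = Φ X + Φ Y)
    (hsmul : ∀ (f : M → ℝ) X, SmoothFunNear E f x → SmoothNear X x → Φ (f • X) = f x • Φ X)
    (hcongr : ∀ X Y, SmoothNear X x → X =ᶠ[𝓝 x] Y → Φ X = Φ Y)
    (hX : SmoothNear X x) (hY : SmoothNear Y x) (h : X x = Y x) : Φ X = Φ Y := by
  have hx := mem_frameSet_self (E := E) x
  have hsm : ∀ {X : ∀ x : M, TangentSpace 𝓘(ℝ, E) x}, SmoothNear X x → ∀ i,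
      SmoothNear ((fun z ↦ frameCoeff x i z (X z)) • coordFrame x i) x := fun hX i ↦
    SmoothFunNear.smul (hX.frameCoeff hx i) (smoothNear_coordFrame hx i)
  have hzero : Φ 0 = 0 := by
    have h0 := hsmul (fun _ ↦ 0) X (SmoothFunNear.const 0) hX
    rw [zero_smul] at h0
    rw [← h0]
    congr 1
    ext y
    simp
  have hz : SmoothNear (0 : ∀ x : M, TangentSpace 𝓘(ℝ, E) x) x := by
    simpa using hX.sub hX
  have hsum : ∀ {X : ∀ x : M, TangentSpace 𝓘(ℝ, E) x}, SmoothNear X x →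
      Φ X = ∑ i, frameCoeff x i x (X x) • Φ (coordFrame x i) := by
    intro X hX
    rw [← hcongr _ _ (SmoothNear.sum (hsm hX)) (eventuallyEq_sum_frameCoeff X hx)]
    -- Smoothness of the partial sums is part of the induction, because additivity of `Φ` is only
    -- available for smooth fields.
    have key : ∀ s : Finset (Fin (finrank ℝ E)),
        SmoothNear (∑ i ∈ s, (fun z ↦ frameCoeff x i z (X z)) • coordFrame x i) x ∧
        Φ (∑ i ∈ s, (fun z ↦ frameCoeff x i z (X z)) • coordFrame x i) =
          ∑ i ∈ s, frameCoeff x i x (X x) • Φ (coordFrame x i) := by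
      intro s
      induction s using Finset.induction_on with
      | empty => exact ⟨by simpa using hz, by simpa using hzero⟩
      | insert a s ha ih =>
        rw [Finset.sum_insert ha, Finset.sum_insert ha]
        refine ⟨(hsm hX a).add ih.1, ?_⟩
        rw [hadd _ _ (hsm hX a) ih.1, ih.2,
          hsmul _ _ (hX.frameCoeff hx a) (smoothNear_coordFrame hx a)]
    rw [← (key Finset.univ).2]
    congr 1
    ext y
    simp
  rw [hsum hX, hsum hY, h]

end Curvature

/-! ### The Riemann tensor: algebraic symmetries and Bianchi identities. -/

section CurvatureIdentities

variable {E : Type*} [NormedAddCommGroup E] [NormedSpace ℝ E] [FiniteDimensional ℝ E]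
  {M : Type*} [TopologicalSpace M] [ChartedSpace E M] [IsManifold 𝓘(ℝ, E) ∞ M]
  {X Y Z W X' Y' Z' : ∀ x : M, TangentSpace 𝓘(ℝ, E) x} {f k : M → ℝ} {x y : M}

theorem SmoothNear.curvature (g : LorentzianMetric E M) (hX : SmoothNear X x)
    (hY : SmoothNear Y x) (hZ : SmoothNear Z x) : SmoothNear (g.curvature X Y Z) x := by
  have := FiniteDimensional.complete ℝ E
  exact ((hX.nabla g (hY.nabla g hZ)).sub (hY.nabla g (hX.nabla g hZ))).sub
    ((hX.bracket hY).nabla g hZ)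

namespace LorentzianMetric

variable (g : LorentzianMetric E M)

theorem curvature_eq_of_eq (hX : SmoothNear X x) (hX' : SmoothNear X' x) (hY : SmoothNear Y x)
    (hY' : SmoothNear Y' x) (hZ : SmoothNear Z x) (hZ' : SmoothNear Z' x)
    (h1 : X x = X' x) (h2 : Y x = Y' x) (h3 : Z x = Z' x) :
    g.curvature X Y Z x = g.curvature X' Y' Z' x := by
  have left : ∀ {X X' Y Z : ∀ x : M, TangentSpace 𝓘(ℝ, E) x}, SmoothNear X x → SmoothNear X' x →
      SmoothNear Z x → X x = X' x → g.curvature X Y Z x = g.curvature X' Y Z x :=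
    fun {X X' Y Z} hX hX' hZ h ↦ eq_of_tensorial (fun X ↦ g.curvature X Y Z x)
      (fun _ _ h1 h2 ↦ g.curvature_add_left h1 h2 hZ)
      (fun _ _ hf h1 ↦ g.curvature_smul_left hf h1 hZ)
      (fun _ _ h1 e ↦ g.curvature_congr_left h1 hZ e) hX hX' h
  -- Antisymmetry moves the second argument into the first slot, so tensoriality in the first and
  -- third slots is enough.
  rw [left hX hX' hZ h1, ← neg_inj, ← curvature_swap, ← curvature_swap, left hY hY' hZ h2]
  exact eq_of_tensorial (fun Z ↦ g.curvature Y' X' Z x)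
    (fun _ _ h1 h2 ↦ g.curvature_add_right hY' hX' h1 h2)
    (fun _ _ hf h1 ↦ g.curvature_smul_right hf hY' hX' h1)
    (fun _ _ h1 e ↦ g.curvature_congr_right hY' hX' h1 e) hZ hZ' h3

/-- The curvature as a tensor at `x`. -/
noncomputable def riemann (x : M) (u w z : TangentSpace 𝓘(ℝ, E) x) : TangentSpace 𝓘(ℝ, E) x :=
  g.curvature (extend E u) (extend E w) (extend E z) x

theorem curvature_eq_riemann (hX : SmoothNear X x) (hY : SmoothNear Y x) (hZ : SmoothNear Z x) :
    g.curvature X Y Z x = g.riemann x (X x) (Y x) (Z x) :=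
  g.curvature_eq_of_eq hX (smoothNear_extend _) hY (smoothNear_extend _) hZ (smoothNear_extend _)
    (by simp) (by simp) (by simp)

theorem riemann_add_left (u u' w z : TangentSpace 𝓘(ℝ, E) x) :
    g.riemann x (u + u') w z = g.riemann x u w z + g.riemann x u' w z := by
  have h := g.curvature_add_left (Y := extend E w) (smoothNear_extend u) (smoothNear_extend u')
    (smoothNear_extend z)
  rw [g.curvature_eq_riemann ((smoothNear_extend u).add (smoothNear_extend u'))
    (smoothNear_extend w) (smoothNear_extend z)] at h
  simpa [riemann] using h

theorem riemann_smul_left (c : ℝ) (u w z : TangentSpace 𝓘(ℝ, E) x) :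
    g.riemann x (c • u) w z = c • g.riemann x u w z := by
  have h := g.curvature_smul_left (Y := extend E w) (f := fun _ ↦ c) (SmoothFunNear.const c)
    (smoothNear_extend u) (smoothNear_extend z)
  rw [g.curvature_eq_riemann ((SmoothFunNear.const c).smul (smoothNear_extend u))
    (smoothNear_extend w) (smoothNear_extend z)] at h
  simpa [riemann] using h

theorem riemann_swap (u w z : TangentSpace 𝓘(ℝ, E) x) :
    g.riemann x w u z = -g.riemann x u w z := g.curvature_swap

theorem riemann_add_mid (u w w' z : TangentSpace 𝓘(ℝ, E) x) :
    g.riemann x u (w + w') z = g.riemann x u w z + g.riemann x u w' z := by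
  rw [g.riemann_swap, riemann_add_left, g.riemann_swap u w, g.riemann_swap u w']
  abel

theorem riemann_smul_mid (c : ℝ) (u w z : TangentSpace 𝓘(ℝ, E) x) :
    g.riemann x u (c • w) z = c • g.riemann x u w z := by
  rw [g.riemann_swap, riemann_smul_left, g.riemann_swap u w, smul_neg, neg_neg]

/-- First Bianchi identity. -/
theorem riemann_cyclic (u w z : TangentSpace 𝓘(ℝ, E) x) :
    g.riemann x u w z + g.riemann x w z u + g.riemann x z u w = 0 := by
  have := FiniteDimensional.complete ℝ E
  set X : ∀ x : M, TangentSpace 𝓘(ℝ, E) x := extend E u with hX_def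
  set Y : ∀ x : M, TangentSpace 𝓘(ℝ, E) x := extend E w with hY_def
  set Z : ∀ x : M, TangentSpace 𝓘(ℝ, E) x := extend E z with hZ_def
  have hX : SmoothNear X x := smoothNear_extend u
  have hY : SmoothNear Y x := smoothNear_extend w
  have hZ : SmoothNear Z x := smoothNear_extend z
  -- Torsion-freeness applied twice. In the cyclic sum the left sides add up to the cyclic sum of
  -- the curvatures, and the right sides to zero by Jacobi.
  have key : ∀ {X Y Z : ∀ x : M, TangentSpace 𝓘(ℝ, E) x}, SmoothNear X x → SmoothNear Y x →
      SmoothNear Z x → g.nabla X (g.nabla Y Z) x - g.nabla X (g.nabla Z Y) x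
        - g.nabla (mlieBracket 𝓘(ℝ, E) Y Z) X x
        = mlieBracket 𝓘(ℝ, E) X (mlieBracket 𝓘(ℝ, E) Y Z) x := by
    intro X Y Z hX hY hZ
    rw [g.mlieBracket_eq hX (hY.bracket hZ), ← g.nabla_sub (hY.nabla g hZ) (hZ.nabla g hY)]
    congr 1
    refine g.nabla_congr ((hY.nabla g hZ).sub (hZ.nabla g hY)) ?_
    filter_upwards [hY.eventually, hZ.eventually] with y h1 h2
    exact (g.mlieBracket_eq h1 h2).symm
  have h1 := key hX hY hZ
  have h2 := key hY hZ hX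
  have h3 := key hZ hX hY
  have hJ := mlieBracket_jacobi hX hY hZ
  have hs1 : mlieBracket 𝓘(ℝ, E) (mlieBracket 𝓘(ℝ, E) X Y) Z x
      = -mlieBracket 𝓘(ℝ, E) Z (mlieBracket 𝓘(ℝ, E) X Y) x := mlieBracket_swap_apply
  have hs2 : mlieBracket 𝓘(ℝ, E) Y (mlieBracket 𝓘(ℝ, E) X Z) x
      = -mlieBracket 𝓘(ℝ, E) Y (mlieBracket 𝓘(ℝ, E) Z X) x := by
    rw [g.mlieBracket_eq hY (hX.bracket hZ), g.mlieBracket_eq hY (hZ.bracket hX),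
      mlieBracket_swap (V := X)]
    rw [g.nabla_neg (hZ.bracket hX)]
    simp only [nabla, Pi.neg_apply, map_neg]
    abel
  change g.curvature X Y Z x + g.curvature Y Z X x + g.curvature Z X Y x = 0
  simp only [curvature_def]
  rw [hs1, hs2, ← h1, ← h2, ← h3] at hJ
  rw [← sub_eq_zero.mpr hJ]
  abel

/-- The curvature operator is skew-adjoint. -/
theorem riemann_skew (u w z t : TangentSpace 𝓘(ℝ, E) x) :
    g.val x (g.riemann x u w z) t = -g.val x (g.riemann x u w t) z := by
  have := FiniteDimensional.complete ℝ E
  set X : ∀ x : M, TangentSpace 𝓘(ℝ, E) x := extend E u with hX_def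
  set Y : ∀ x : M, TangentSpace 𝓘(ℝ, E) x := extend E w with hY_def
  set Z : ∀ x : M, TangentSpace 𝓘(ℝ, E) x := extend E z with hZ_def
  set W : ∀ x : M, TangentSpace 𝓘(ℝ, E) x := extend E t with hW_def
  have hX : SmoothNear X x := smoothNear_extend u
  have hY : SmoothNear Y x := smoothNear_extend w
  have hZ : SmoothNear Z x := smoothNear_extend z
  have hW : SmoothNear W x := smoothNear_extend t
  have hZx : Z x = z := by simp [Z]
  have hWx : W x = t := by simp [W]
  -- The mixed terms are symmetric in X and Y, so they drop out of X(Y g(Z,W)) - Y(X g(Z,W)).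
  -- Comparison with [X,Y] g(Z,W) leaves g(R(X,Y)Z,W) + g(Z,R(X,Y)W) = 0.
  have key : ∀ {X Y : ∀ x : M, TangentSpace 𝓘(ℝ, E) x}, SmoothNear X x → SmoothNear Y x →
      mvfderiv 𝓘(ℝ, E) (fun y ↦ mvfderiv 𝓘(ℝ, E) (fun y ↦ g.val y (Z y) (W y)) y (Y y)) x (X x) =
        g.val x (g.nabla X (g.nabla Y Z) x) (W x) + g.val x (g.nabla Y Z x) (g.nabla X W x)
        + (g.val x (g.nabla X Z x) (g.nabla Y W x) + g.val x (Z x) (g.nabla X (g.nabla Y W) x)) := by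
    intro X Y hX hY
    have e : (fun y ↦ mvfderiv 𝓘(ℝ, E) (fun y ↦ g.val y (Z y) (W y)) y (Y y)) =ᶠ[𝓝 x]
        fun y ↦ g.val y (g.nabla Y Z y) (W y) + g.val y (Z y) (g.nabla Y W y) := by
      filter_upwards [hZ.eventually, hW.eventually] with y h1 h2
      exact g.mvfderiv_inner h1 h2
    rw [mvfderiv_congr e, mvfderiv_fun_add ((hY.nabla g hZ).metric g hW).mdiff
      (hZ.metric g (hY.nabla g hW)).mdiff, add_apply, g.mvfderiv_inner (hY.nabla g hZ) hW,
      g.mvfderiv_inner hZ (hY.nabla g hW)]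
  have h := mvfderiv_mlieBracket (hZ.metric g hW) hX hY
  rw [key hX hY, key hY hX, g.mvfderiv_inner (Z := mlieBracket 𝓘(ℝ, E) X Y) hZ hW] at h
  change g.val x (g.curvature X Y Z x) t = -g.val x (g.curvature X Y W x) z
  rw [g.symm x (g.curvature X Y W x), ← hZx, ← hWx]
  simp only [curvature_def, map_sub, sub_apply]
  linarith

/-- Pair symmetry of the curvature tensor. -/
theorem riemann_pair_symm (u w z t : TangentSpace 𝓘(ℝ, E) x) :
    g.val x (g.riemann x u w z) t = g.val x (g.riemann x z t u) w := by
  have cyc : ∀ u w z t : TangentSpace 𝓘(ℝ, E) x, g.val x (g.riemann x u w z) t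
      + g.val x (g.riemann x w z u) t + g.val x (g.riemann x z u w) t = 0 := fun u w z t ↦ by
    have := congrArg (fun v ↦ g.val x v t) (g.riemann_cyclic u w z)
    simpa using this
  have sw : ∀ u w z t : TangentSpace 𝓘(ℝ, E) x, g.val x (g.riemann x w u z) t =
      - g.val x (g.riemann x u w z) t := fun u w z t ↦ by
    rw [g.riemann_swap u w z, map_neg, neg_apply]
  -- The octahedron argument: four instances of the first Bianchi identity, combined through the two
  -- antisymmetries.
  have c1 := cyc u w z t
  have c2 := cyc w z t u
  have c3 := cyc z t u w
  have c4 := cyc t u w z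
  linarith [g.riemann_skew u w z t, g.riemann_skew w z u t, g.riemann_skew z u w t,
    g.riemann_skew z t w u, g.riemann_skew t w z u, g.riemann_skew t u z w,
    g.riemann_skew u z t w, g.riemann_skew u w t z, g.riemann_skew w t u z,
    sw u w z t, sw w z u t, sw z u w t, sw z t w u, sw t w z u, sw t u z w, sw u z t w,
    sw w t u z, sw z t u w, sw u w t z]

/-- Second Bianchi identity. -/
theorem curvature_second_bianchi (hX : SmoothNear X x) (hY : SmoothNear Y x) (hZ : SmoothNear Z x)
    (hW : SmoothNear W x) :
    (g.nabla X (g.curvature Y Z W) x - g.curvature Y Z (g.nabla X W) x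
        - g.curvature (mlieBracket 𝓘(ℝ, E) X Y) Z W x)
      + (g.nabla Y (g.curvature Z X W) x - g.curvature Z X (g.nabla Y W) x
        - g.curvature (mlieBracket 𝓘(ℝ, E) Y Z) X W x)
      + (g.nabla Z (g.curvature X Y W) x - g.curvature X Y (g.nabla Z W) x
        - g.curvature (mlieBracket 𝓘(ℝ, E) Z X) Y W x) = 0 := by
  have := FiniteDimensional.complete ℝ E
  have key : ∀ {X Y Z : ∀ x : M, TangentSpace 𝓘(ℝ, E) x}, SmoothNear X x → SmoothNear Y x →
      SmoothNear Z x → g.nabla X (g.curvature Y Z W) x = g.nabla X (g.nabla Y (g.nabla Z W)) x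
        - g.nabla X (g.nabla Z (g.nabla Y W)) x
        - g.nabla X (g.nabla (mlieBracket 𝓘(ℝ, E) Y Z) W) x := by
    intro X Y Z hX hY hZ
    have h1 := hY.nabla g (hZ.nabla g hW)
    have h2 := hZ.nabla g (hY.nabla g hW)
    have h3 := (hY.bracket hZ).nabla g hW
    rw [← g.nabla_sub h1 h2, ← g.nabla_sub (h1.sub h2) h3]
    rfl
  -- Once the curvatures are expanded, all iterated derivatives of W cancel; only derivatives of W
  -- along double brackets remain, and these sum to zero by Jacobi.
  have hJ : g.leviCivita W x (mlieBracket 𝓘(ℝ, E) (mlieBracket 𝓘(ℝ, E) X Y) Z x)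
      + g.leviCivita W x (mlieBracket 𝓘(ℝ, E) (mlieBracket 𝓘(ℝ, E) Y Z) X x)
      + g.leviCivita W x (mlieBracket 𝓘(ℝ, E) (mlieBracket 𝓘(ℝ, E) Z X) Y x) = 0 := by
    have hJ := mlieBracket_jacobi hX hY hZ
    have h0 : mlieBracket 𝓘(ℝ, E) Y (mlieBracket 𝓘(ℝ, E) X Z) x
        = mlieBracket 𝓘(ℝ, E) (mlieBracket 𝓘(ℝ, E) Z X) Y x := by
      rw [mlieBracket_swap_apply (V := Y), mlieBracket_swap (V := X),
        ← neg_one_smul ℝ (mlieBracket 𝓘(ℝ, E) Z X),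
        mlieBracket_const_smul_left (hZ.bracket hX).mdiff]
      simp
    have h1 : mlieBracket 𝓘(ℝ, E) (mlieBracket 𝓘(ℝ, E) Y Z) X x
        = -mlieBracket 𝓘(ℝ, E) X (mlieBracket 𝓘(ℝ, E) Y Z) x := mlieBracket_swap_apply
    rw [← map_add, ← map_add, h1, hJ, h0]
    rw [show ∀ a b : TangentSpace 𝓘(ℝ, E) x, a + -(a + b) + b = 0 from fun a b ↦ by abel, map_zero]
  rw [key hX hY hZ, key hY hZ hX, key hZ hX hY]
  simp only [curvature_def]
  rw [← hJ]
  simp only [nabla]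
  abel

end LorentzianMetric

end CurvatureIdentities

/-! ### Traces of endomorphism fields and the Ricci tensor. -/

section Trace

variable {E : Type*} [NormedAddCommGroup E] [NormedSpace ℝ E] [FiniteDimensional ℝ E]
  {M : Type*} [TopologicalSpace M] [ChartedSpace E M] [IsManifold 𝓘(ℝ, E) ∞ M]
  {X Y Z W X' Y' Z' : ∀ x : M, TangentSpace 𝓘(ℝ, E) x} {f k : M → ℝ} {x y : M}

theorem mvfderiv_finset_sum {ι : Type*} (s : Finset ι) {f : ι → M → ℝ}
    (h : ∀ i, SmoothFunNear E (f i) x) (u : TangentSpace 𝓘(ℝ, E) x) :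
    mvfderiv 𝓘(ℝ, E) (fun y ↦ ∑ i ∈ s, f i y) x u = ∑ i ∈ s, mvfderiv 𝓘(ℝ, E) (f i) x u := by
  classical
  induction s using Finset.induction_on with
  | empty => simp [mvfderiv_const]
  | insert a s ha ih =>
    simp only [Finset.sum_insert ha]
    rw [mvfderiv_fun_add (h a).mdiff (SmoothFunNear.sum s fun i _ ↦ h i).mdiff, add_apply, ih]

theorem trace_eq_sum_frameCoeff (hy : y ∈ frameSet E x)
    (B : TangentSpace 𝓘(ℝ, E) y →ₗ[ℝ] TangentSpace 𝓘(ℝ, E) y) :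
    LinearMap.trace ℝ _ B = ∑ i, frameCoeff x i y (B (coordFrame x i y)) := by
  rw [LinearMap.trace_eq_matrix_trace ℝ (frameBasis hy), Matrix.trace]
  simp only [Matrix.diag_apply, LinearMap.toMatrix_apply, frameBasis_repr, frameBasis_apply]

theorem trace_eventuallyEq (T : ∀ y : M, TangentSpace 𝓘(ℝ, E) y →ₗ[ℝ] TangentSpace 𝓘(ℝ, E) y)
    (x : M) : (fun y ↦ LinearMap.trace ℝ _ (T y)) =ᶠ[𝓝 x]
      fun y ↦ ∑ i, frameCoeff x i y (T y (coordFrame x i y)) := by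
  filter_upwards [eventually_mem_frameSet (mem_frameSet_self (E := E) x)] with y hy
  exact trace_eq_sum_frameCoeff hy _

theorem smoothFunNear_trace
    (T : ∀ y : M, TangentSpace 𝓘(ℝ, E) y →ₗ[ℝ] TangentSpace 𝓘(ℝ, E) y)
    (hT : ∀ X : (∀ x : M, TangentSpace 𝓘(ℝ, E) x), SmoothNear X x →
      SmoothNear (fun y ↦ T y (X y)) x) :
    SmoothFunNear E (fun y ↦ LinearMap.trace ℝ _ (T y)) x :=
  (SmoothFunNear.sum Finset.univ fun i _ ↦ (hT _ (smoothNear_coordFrame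
    (mem_frameSet_self x) i)).frameCoeff (mem_frameSet_self x) i).congr
      (trace_eventuallyEq T x).symm

namespace LorentzianMetric

variable (g : LorentzianMetric E M)

theorem nabla_finset_sum {ι : Type*} (s : Finset ι)
    {Y : ι → ∀ x : M, TangentSpace 𝓘(ℝ, E) x} (h : ∀ i, SmoothNear (Y i) x) :
    SmoothNear (fun y ↦ ∑ i ∈ s, Y i y) x ∧
      g.nabla X (fun y ↦ ∑ i ∈ s, Y i y) x = ∑ i ∈ s, g.nabla X (Y i) x := by
  classical
  induction s using Finset.induction_on with
  | empty =>
    simp only [Finset.sum_empty]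
    refine ⟨Eventually.of_forall fun y ↦ contMDiff_zeroSection ℝ (TangentSpace 𝓘(ℝ, E)) y, ?_⟩
    have := g.leviCivita.zero
    exact congrArg (fun L ↦ L x (X x)) this
  | insert a s ha ih =>
    simp only [Finset.sum_insert ha]
    refine ⟨(h a).add ih.1, ?_⟩
    rw [← ih.2]
    exact g.nabla_add (h a) ih.1

/-- The derivative of the trace of a field of endomorphisms is the trace of its covariant
derivative. -/
theorem mvfderiv_trace (T : ∀ y : M, TangentSpace 𝓘(ℝ, E) y →ₗ[ℝ] TangentSpace 𝓘(ℝ, E) y)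
    (hT : ∀ X : (∀ x : M, TangentSpace 𝓘(ℝ, E) x), SmoothNear X x →
      SmoothNear (fun y ↦ T y (X y)) x)
    (U : ∀ x : M, TangentSpace 𝓘(ℝ, E) x)
    (A : TangentSpace 𝓘(ℝ, E) x →ₗ[ℝ] TangentSpace 𝓘(ℝ, E) x)
    (hA : ∀ X : (∀ x : M, TangentSpace 𝓘(ℝ, E) x), SmoothNear X x →
      g.nabla U (fun y ↦ T y (X y)) x = T x (g.nabla U X x) + A (X x)) :
    mvfderiv 𝓘(ℝ, E) (fun y ↦ LinearMap.trace ℝ _ (T y)) x (U x) = LinearMap.trace ℝ _ A := by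
  have hx := mem_frameSet_self (E := E) x
  -- `D` is the connection form of the frame evaluated at `U x`: it measures the failure of the
  -- frame to be parallel, hence the correction in `hcoeff`.
  let D : TangentSpace 𝓘(ℝ, E) x →ₗ[ℝ] TangentSpace 𝓘(ℝ, E) x :=
    (frameBasis hx).constr ℝ fun k ↦ g.nabla U (coordFrame x k) x
  have hD : ∀ k, D (coordFrame x k x) = g.nabla U (coordFrame x k) x := fun k ↦ by
    rw [← frameBasis_apply hx, Basis.constr_basis]
  have hs := fun i ↦ smoothNear_coordFrame hx i
  have hcoeff : ∀ V : (∀ x : M, TangentSpace 𝓘(ℝ, E) x), SmoothNear V x → ∀ i,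
      mvfderiv 𝓘(ℝ, E) (fun y ↦ frameCoeff x i y (V y)) x (U x) =
        frameCoeff x i x (g.nabla U V x - D (V x)) := by
    intro V hV i
    have hsm : ∀ k, SmoothNear ((fun y ↦ frameCoeff x k y (V y)) • coordFrame x k) x :=
      fun k ↦ (hV.frameCoeff hx k).smul (hs k)
    rw [← g.nabla_congr (g.nabla_finset_sum (X := U) Finset.univ hsm).1
      (eventuallyEq_sum_frameCoeff V hx), (g.nabla_finset_sum (X := U) Finset.univ hsm).2,
      Finset.sum_congr rfl fun k _ ↦ g.nabla_smul (hV.frameCoeff hx k) (hs k),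
      Finset.sum_add_distrib]
    conv_rhs => rw [← sum_frameCoeff_smul hx (V x)]
    simp only [map_sum, map_smul, hD]
    simp [frameCoeff_coordFrame hx]
  rw [mvfderiv_congr (trace_eventuallyEq T x), mvfderiv_finset_sum _ fun i ↦ (hT _ (hs i)).frameCoeff hx i,
    Finset.sum_congr rfl fun i _ ↦ hcoeff _ (hT _ (hs i)) i]
  -- The derivative of the trace is now tr A + tr(TD) - tr(DT), and the frame-dependent part is the
  -- trace of a commutator.
  have hcomm : LinearMap.trace ℝ _ (T x ∘ₗ D) = LinearMap.trace ℝ _ (D ∘ₗ T x) :=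
    LinearMap.trace_mul_comm ℝ (T x) D
  rw [trace_eq_sum_frameCoeff hx, trace_eq_sum_frameCoeff hx] at hcomm
  rw [trace_eq_sum_frameCoeff hx A]
  simp only [LinearMap.comp_apply, hD] at hcomm
  simp only [hA _ (hs _), map_add, map_sub, Finset.sum_sub_distrib, Finset.sum_add_distrib]
  linarith

/-- The endomorphism `u ↦ R(u, w) z`, whose trace is the Ricci tensor. -/
noncomputable def ricciEndo (x : M) (w z : TangentSpace 𝓘(ℝ, E) x) :
    TangentSpace 𝓘(ℝ, E) x →ₗ[ℝ] TangentSpace 𝓘(ℝ, E) x where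
  toFun u := g.riemann x u w z
  map_add' u u' := g.riemann_add_left u u' w z
  map_smul' c u := g.riemann_smul_left c u w z

theorem ricci_eq_trace (w z : TangentSpace 𝓘(ℝ, E) x) :
    g.ricci x w z = LinearMap.trace ℝ _ (g.ricciEndo x w z) := by
  rw [LinearMap.trace_eq_matrix_trace ℝ (tangentBasis x), Matrix.trace]
  simp only [Matrix.diag_apply, LinearMap.toMatrix_apply]
  rfl

theorem curvature_eventuallyEq_ricciEndo (hX : SmoothNear X x) (hY : SmoothNear Y x)
    (hZ : SmoothNear Z x) :
    g.curvature X Y Z =ᶠ[𝓝 x] fun y ↦ g.ricciEndo y (Y y) (Z y) (X y) := by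
  filter_upwards [hX.eventually, hY.eventually, hZ.eventually] with y h1 h2 h3
  exact g.curvature_eq_riemann h1 h2 h3

theorem smoothNear_ricciEndo (hX : SmoothNear X x) (hY : SmoothNear Y x) (hZ : SmoothNear Z x) :
    SmoothNear (fun y ↦ g.ricciEndo y (Y y) (Z y) (X y)) x :=
  (hX.curvature g hY hZ).congr (g.curvature_eventuallyEq_ricciEndo hX hY hZ)

theorem smoothFunNear_ricci (hY : SmoothNear Y x) (hZ : SmoothNear Z x) :
    SmoothFunNear E (fun y ↦ g.ricci y (Y y) (Z y)) x := by
  simp only [ricci_eq_trace]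
  exact smoothFunNear_trace _ fun X hX ↦ g.smoothNear_ricciEndo hX hY hZ

end LorentzianMetric

end Trace

/-! ### Curvature of LP-Kenmotsu manifolds. -/

namespace LorentzianAlmostParacontact

variable {E : Type*} [NormedAddCommGroup E] [NormedSpace ℝ E] [FiniteDimensional ℝ E]
  {M : Type*} [TopologicalSpace M] [ChartedSpace E M] [IsManifold 𝓘(ℝ, E) ∞ M]
  {X Y Z W X' Y' Z' : ∀ x : M, TangentSpace 𝓘(ℝ, E) x} {f k : M → ℝ} {x y : M}
  {P : LorentzianAlmostParacontact E M}

theorem smoothNear_ζ (P : LorentzianAlmostParacontact E M) (x : M) : SmoothNear P.ζ x :=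
  Eventually.of_forall fun y ↦ P.contMDiff_ζ y

theorem val_ζ_left (P : LorentzianAlmostParacontact E M) (u : TangentSpace 𝓘(ℝ, E) x) :
    P.g.val x (P.ζ x) u = P.ν x u := by
  rw [P.g.symm, P.g_ζ]

theorem ν_apply_ζ (P : LorentzianAlmostParacontact E M) (x : M) : P.ν x (P.ζ x) = -1 := by
  linarith [P.ν_ζ x]

theorem smoothFunNear_ν (P : LorentzianAlmostParacontact E M) (hX : SmoothNear X x) :
    SmoothFunNear E (fun y ↦ P.ν y (X y)) x := by
  simpa only [P.g_ζ] using hX.metric P.g (P.smoothNear_ζ x)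

namespace IsLPKenmotsu

/-- The structure equation with F = ζ gives φ(∇_u ζ) = -φu, because φζ = 0. A second φ recovers ∇_u
ζ up to its ν-component, which vanishes because g(ζ,ζ) = -1 is constant. -/
theorem leviCivita_ζ (hP : P.IsLPKenmotsu) (x : M) (u : TangentSpace 𝓘(ℝ, E) x) :
    P.g.leviCivita P.ζ x u = -u - P.ν x u • P.ζ x := by
  have hζ := P.smoothNear_ζ x
  have h0 : P.ν x (P.g.leviCivita P.ζ x u) = 0 := by
    have h := P.g.isLeviCivita_leviCivita.metric x u P.ζ P.ζ hζ.mdiff hζ.mdiff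
    simp only [P.g_ζ, P.ν_apply_ζ, mvfderiv_const, P.val_ζ_left, zero_apply] at h
    linarith
  have h1 := hP x u P.ζ hζ.mdiff
  have h2 : (fun y ↦ P.φ y (P.ζ y)) = 0 := funext P.φ_ζ
  rw [h2, P.g.leviCivita.zero, P.g_ζ, P.ν_φ, P.ν_apply_ζ] at h1
  have h3 : P.φ x (P.g.leviCivita P.ζ x u) = -P.φ x u := by
    have h4 : -P.φ x (P.g.leviCivita P.ζ x u) = P.φ x u := by simpa using h1
    rw [← h4, neg_neg]
  have h5 := congrArg (P.φ x) h3
  rw [map_neg, P.φ_φ, P.φ_φ, h0, zero_smul, add_zero] at h5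
  rw [h5]
  abel

theorem nabla_ζ (hP : P.IsLPKenmotsu) (X : ∀ x : M, TangentSpace 𝓘(ℝ, E) x) (x : M) :
    P.g.nabla X P.ζ x = -X x - P.ν x (X x) • P.ζ x := hP.leviCivita_ζ x (X x)

/-- This is ∇ν = -(g + ν⊗ν). The right side is symmetric, so ν is closed; it vanishes when one
argument is ζ, so ∇_ζ ν = 0. -/
theorem mvfderiv_ν (hP : P.IsLPKenmotsu) (hY : SmoothNear Y x) :
    mvfderiv 𝓘(ℝ, E) (fun y ↦ P.ν y (Y y)) x (X x) =
      P.ν x (P.g.nabla X Y x) - P.g.val x (X x) (Y x) - P.ν x (X x) * P.ν x (Y x) := by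
  have h := P.g.mvfderiv_inner (Z := X) hY (P.smoothNear_ζ x)
  rw [hP.nabla_ζ, P.g_ζ] at h
  simp only [P.g_ζ, map_sub, map_neg, map_smul, smul_eq_mul] at h
  rw [h, P.g.symm x (Y x)]
  ring

theorem riemann_ζ_right (hP : P.IsLPKenmotsu) (u w : TangentSpace 𝓘(ℝ, E) x) :
    P.g.riemann x u w (P.ζ x) = P.ν x w • u - P.ν x u • w := by
  -- Covariant derivative of ∇_Y ζ = -Y - ν(Y)ζ. Antisymmetrising in X and Y removes the symmetric
  -- terms g(X,Y) and ν(X)ν(Y).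
  have key : ∀ {X Y : ∀ x : M, TangentSpace 𝓘(ℝ, E) x}, SmoothNear X x → SmoothNear Y x →
      P.g.nabla X (P.g.nabla Y P.ζ) x = -P.g.nabla X Y x + P.ν x (Y x) • X x
        - (P.ν x (P.g.nabla X Y x) - P.g.val x (X x) (Y x) - 2 * P.ν x (X x) * P.ν x (Y x)) •
          P.ζ x := by
    intro X Y hX hY
    have e : P.g.nabla Y P.ζ = -Y - (fun y ↦ P.ν y (Y y)) • P.ζ := funext fun y ↦ hP.nabla_ζ Y y
    rw [e, P.g.nabla_sub hY.neg ((P.smoothFunNear_ν hY).smul (P.smoothNear_ζ x)), P.g.nabla_neg hY,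
      P.g.nabla_smul (P.smoothFunNear_ν hY) (P.smoothNear_ζ x), hP.mvfderiv_ν hY, hP.nabla_ζ]
    module
  have hX : SmoothNear (extend E u) x := smoothNear_extend u
  have hY : SmoothNear (extend E w) x := smoothNear_extend w
  have h := P.g.curvature_eq_riemann hX hY (P.smoothNear_ζ x)
  rw [P.g.curvature_def, key hX hY, key hY hX, hP.nabla_ζ, P.g.mlieBracket_eq hX hY,
    map_sub, P.g.symm x _ (extend E u x)] at h
  simp only [extend_apply_self] at h
  rw [← h]
  module

/-- Pair symmetry and skew-adjointness reduce g(R(w,ζ)z,t) to a curvature operator acting on ζ,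
which is already known. -/
theorem riemann_ζ_mid (hP : P.IsLPKenmotsu) (w z : TangentSpace 𝓘(ℝ, E) x) :
    P.g.riemann x w (P.ζ x) z = P.ν x z • w - P.g.val x w z • P.ζ x := by
  refine P.g.ext_of_forall fun t ↦ ?_
  rw [P.g.riemann_pair_symm, P.g.riemann_skew, hP.riemann_ζ_right]
  simp only [map_sub, map_smul, sub_apply, smul_apply, smul_eq_mul, P.val_ζ_left]
  rw [P.g.symm x z w, P.g.symm x t w]
  ring

theorem riemann_ζ_left (hP : P.IsLPKenmotsu) (w z : TangentSpace 𝓘(ℝ, E) x) :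
    P.g.riemann x (P.ζ x) w z = P.g.val x w z • P.ζ x - P.ν x z • w := by
  rw [P.g.riemann_swap, hP.riemann_ζ_mid]
  abel

theorem ricci_ζ (hP : P.IsLPKenmotsu) (w : TangentSpace 𝓘(ℝ, E) x) :
    P.g.ricci x w (P.ζ x) = (finrank ℝ E - 1) * P.ν x w := by
  have e : P.g.ricciEndo x w (P.ζ x) =
      P.ν x w • LinearMap.id - (P.ν x).toLinearMap.smulRight w := by
    ext u
    exact hP.riemann_ζ_right u w
  have hfin : FiniteDimensional ℝ (TangentSpace 𝓘(ℝ, E) x) :=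
    inferInstanceAs (FiniteDimensional ℝ E)
  have hrank : finrank ℝ (TangentSpace 𝓘(ℝ, E) x) = finrank ℝ E := rfl
  rw [P.g.ricci_eq_trace, e, map_sub, map_smul, LinearMap.trace_id, LinearMap.trace_smulRight,
    hrank]
  simp only [smul_eq_mul, ContinuousLinearMap.coe_coe]
  ring

/-- In tensor form, (∇_ζ R)(X,Y)Z = 2(R(X,Y)Z - g(Y,Z)X + g(X,Z)Y). This is the second Bianchi
identity for ζ, X, Y: the other two derivatives involve only curvatures with an argument ζ, which
are explicit. The factor 2 arises because [ζ,X] and [ζ,Y] contain the summands X and Y, each of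
which contributes one R(X,Y)Z. -/
theorem nabla_curvature_ζ (hP : P.IsLPKenmotsu) (hX : SmoothNear X x) (hY : SmoothNear Y x)
    (hZ : SmoothNear Z x) :
    P.g.nabla P.ζ (P.g.curvature X Y Z) x = P.g.riemann x (P.g.nabla P.ζ X x) (Y x) (Z x)
      + P.g.riemann x (X x) (P.g.nabla P.ζ Y x) (Z x)
      + P.g.riemann x (X x) (Y x) (P.g.nabla P.ζ Z x)
      + (2 : ℝ) • (P.g.riemann x (X x) (Y x) (Z x)
        - (P.g.val x (Y x) (Z x) • X x - P.g.val x (X x) (Z x) • Y x)) := by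
  have := FiniteDimensional.complete ℝ E
  have hζ := P.smoothNear_ζ x
  have hνZ := P.smoothFunNear_ν hZ
  have hB := P.g.curvature_second_bianchi hζ hX hY hZ
  have key : ∀ {X Y : ∀ x : M, TangentSpace 𝓘(ℝ, E) x}, SmoothNear X x → SmoothNear Y x →
      P.g.nabla X (P.g.curvature Y P.ζ Z) x =
        (P.ν x (P.g.nabla X Z x) - P.g.val x (X x) (Z x) - P.ν x (X x) * P.ν x (Z x)) • Y x
        + P.ν x (Z x) • P.g.nabla X Y x + P.g.val x (Y x) (Z x) • (X x + P.ν x (X x) • P.ζ x)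
        - (P.g.val x (P.g.nabla X Y x) (Z x) + P.g.val x (Y x) (P.g.nabla X Z x)) • P.ζ x := by
    intro X Y hX hY
    have e : P.g.curvature Y P.ζ Z =ᶠ[𝓝 x]
        (fun y ↦ P.ν y (Z y)) • Y - (fun y ↦ P.g.val y (Y y) (Z y)) • P.ζ := by
      filter_upwards [hY.eventually, hZ.eventually] with y h1 h2
      rw [P.g.curvature_eq_riemann h1 (P.smoothNear_ζ y) h2, hP.riemann_ζ_mid]
      rfl
    have hg := hY.metric P.g hZ
    rw [P.g.nabla_congr (hY.curvature P.g hζ hZ) e,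
      P.g.nabla_sub (hνZ.smul hY) (hg.smul hζ), P.g.nabla_smul hνZ hY, P.g.nabla_smul hg hζ,
      hP.mvfderiv_ν hZ, P.g.mvfderiv_inner hY hZ, hP.nabla_ζ]
    module
  have hswap : P.g.nabla Y (P.g.curvature P.ζ X Z) x = -P.g.nabla Y (P.g.curvature X P.ζ Z) x := by
    rw [← P.g.nabla_neg (hX.curvature P.g hζ hZ)]
    congr 1
    ext y
    exact P.g.curvature_swap
  have hbr : ∀ {X : ∀ x : M, TangentSpace 𝓘(ℝ, E) x}, SmoothNear X x →
      mlieBracket 𝓘(ℝ, E) P.ζ X x = P.g.nabla P.ζ X x + X x + P.ν x (X x) • P.ζ x := by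
    intro X hX
    rw [P.g.mlieBracket_eq hζ hX, hP.nabla_ζ]
    abel
  rw [hswap, key hX hY, key hY hX,
    P.g.curvature_eq_riemann hX hY (hζ.nabla P.g hZ),
    P.g.curvature_eq_riemann (hζ.bracket hX) hY hZ,
    P.g.curvature_eq_riemann hY hζ (hX.nabla P.g hZ),
    P.g.curvature_eq_riemann (hX.bracket hY) hζ hZ,
    P.g.curvature_eq_riemann hζ hX (hY.nabla P.g hZ),
    P.g.curvature_eq_riemann (hY.bracket hζ) hX hZ,
    mlieBracket_swap_apply (V := Y) (W := P.ζ), hbr hX, hbr hY, P.g.mlieBracket_eq hX hY,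
    hP.riemann_ζ_mid, hP.riemann_ζ_mid, hP.riemann_ζ_left,
    P.g.riemann_swap (X x) (-_) (Z x), ← neg_one_smul ℝ (P.g.nabla P.ζ Y x + _ + _),
    P.g.riemann_smul_mid] at hB
  simp only [P.g.riemann_add_left, P.g.riemann_add_mid, P.g.riemann_smul_left,
    P.g.riemann_smul_mid, hP.riemann_ζ_left, hP.riemann_ζ_mid, map_sub, sub_apply] at hB
  rw [← sub_eq_zero, ← hB]
  module

/-- `∇_ζ S = 2 S - 2 (n - 1) g` on an LP-Kenmotsu manifold. -/
theorem mvfderiv_ricci_ζ (hP : P.IsLPKenmotsu) (hY : SmoothNear Y x) (hZ : SmoothNear Z x) :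
    mvfderiv 𝓘(ℝ, E) (fun y ↦ P.g.ricci y (Y y) (Z y)) x (P.ζ x) =
      P.g.ricci x (P.g.nabla P.ζ Y x) (Z x) + P.g.ricci x (Y x) (P.g.nabla P.ζ Z x)
        + 2 * P.g.ricci x (Y x) (Z x) - 2 * (finrank ℝ E - 1) * P.g.val x (Y x) (Z x) := by
  have hfin : FiniteDimensional ℝ (TangentSpace 𝓘(ℝ, E) x) :=
    inferInstanceAs (FiniteDimensional ℝ E)
  have hrank : finrank ℝ (TangentSpace 𝓘(ℝ, E) x) = finrank ℝ E := rfl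
  -- Trace the formula for ∇_ζ R over its first argument; the map X ↦ g(Y,Z)X - g(X,Z)Y has trace
  -- (n-1)g(Y,Z).
  have h := P.g.mvfderiv_trace (x := x) (fun y ↦ P.g.ricciEndo y (Y y) (Z y))
    (fun X hX ↦ P.g.smoothNear_ricciEndo hX hY hZ) P.ζ
    (P.g.ricciEndo x (P.g.nabla P.ζ Y x) (Z x) + P.g.ricciEndo x (Y x) (P.g.nabla P.ζ Z x)
      + (2 : ℝ) • (P.g.ricciEndo x (Y x) (Z x) - (P.g.val x (Y x) (Z x) • LinearMap.id
        - (P.g.val x (Z x)).toLinearMap.smulRight (Y x))))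
    (fun X hX ↦ by
      rw [← P.g.nabla_congr (hX.curvature P.g hY hZ)
        (P.g.curvature_eventuallyEq_ricciEndo hX hY hZ), hP.nabla_curvature_ζ hX hY hZ]
      simp only [LorentzianMetric.ricciEndo, LinearMap.add_apply, LinearMap.smul_apply,
        LinearMap.sub_apply, LinearMap.coe_mk, AddHom.coe_mk, LinearMap.id_apply,
        LinearMap.smulRight_apply, ContinuousLinearMap.coe_coe, P.g.symm x (Z x) (X x)]
      abel)
  simp only [map_add, map_sub, map_smul, LinearMap.trace_id, LinearMap.trace_smulRight, hrank,
    ← P.g.ricci_eq_trace, smul_eq_mul, ContinuousLinearMap.coe_coe, P.g.symm x (Z x) (Y x)] at h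
  rw [h]
  ring

end IsLPKenmotsu

end LorentzianAlmostParacontact

/-! ### The soliton equation on an LP-Kenmotsu manifold. -/

section Soliton

variable {E : Type*} [NormedAddCommGroup E] [NormedSpace ℝ E] [FiniteDimensional ℝ E]
  {M : Type*} [TopologicalSpace M] [ChartedSpace E M] [IsManifold 𝓘(ℝ, E) ∞ M]
  {X Y Z W X' Y' Z' : ∀ x : M, TangentSpace 𝓘(ℝ, E) x} {v : M → ℝ} {x y : M}

/-- A differentiable function with vanishing differential is locally constant. -/
theorem isLocallyConstant_of_mvfderiv_eq_zero (hv : MDifferentiable 𝓘(ℝ, E) 𝓘(ℝ) v)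
    (h : ∀ x, mvfderiv 𝓘(ℝ, E) v x = 0) : IsLocallyConstant v := by
  rw [IsLocallyConstant.iff_eventually_eq]
  intro x
  set e := extChartAt 𝓘(ℝ, E) x
  have hopen : IsOpen e.target := isOpen_extChartAt_target x
  have hw : ∀ z ∈ e.target, HasFDerivAt (v ∘ e.symm) (0 : E →L[ℝ] ℝ) z := by
    intro z hz
    have h1 : HasMFDerivAt 𝓘(ℝ, E) 𝓘(ℝ) v (e.symm z) 0 := by
      have h2 := (hv (e.symm z)).hasMFDerivAt
      have h3 : mfderiv 𝓘(ℝ, E) 𝓘(ℝ) v (e.symm z) = 0 := by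
        ext u
        exact congrArg (fun L ↦ L u) (h (e.symm z))
      rwa [h3] at h2
    have h4 : MDifferentiableAt 𝓘(ℝ, E) 𝓘(ℝ, E) e.symm z :=
      ((contMDiffOn_extChartAt_symm (n := ∞) x).contMDiffAt
        (hopen.mem_nhds hz)).mdifferentiableAt (by simp)
    have h5 := h1.comp z h4.hasMFDerivAt
    rw [ContinuousLinearMap.zero_comp] at h5
    exact h5.hasFDerivAt
  -- A ball in the chart is convex, so vanishing derivative gives constancy there.
  obtain ⟨r, hr, hball⟩ := Metric.isOpen_iff.mp hopen (e x) (mem_extChartAt_target x)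
  have hconst : ∀ z ∈ Metric.ball (e x) r, (v ∘ e.symm) z = (v ∘ e.symm) (e x) := fun z hz ↦
    (convex_ball (e x) r).is_const_of_fderivWithin_eq_zero (𝕜 := ℝ)
      (fun z hz ↦ (hw z (hball hz)).differentiableAt.differentiableWithinAt)
      (fun z hz ↦ by
        rw [fderivWithin_of_isOpen Metric.isOpen_ball hz]
        exact (hw z (hball hz)).fderiv) hz (Metric.mem_ball_self hr)
  filter_upwards [(continuousAt_extChartAt (I := 𝓘(ℝ, E)) x).preimage_mem_nhds
    (Metric.ball_mem_nhds (e x) hr), extChartAt_source_mem_nhds (I := 𝓘(ℝ, E)) x] with y hy hys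
  have := hconst (e y) hy
  rwa [Function.comp_apply, Function.comp_apply, e.left_inv hys,
    e.left_inv (mem_extChartAt_source x)] at this

namespace LorentzianMetric

/-- The Hessian may be computed with any smooth extension of its second argument. -/
theorem hessian_eq (g : LorentzianMetric E M) (hv : SmoothFunNear E v x) (hW : SmoothNear W x)
    (u : TangentSpace 𝓘(ℝ, E) x) :
    g.hessian v x u (W x) = mvfderiv 𝓘(ℝ, E) (fun y ↦ mvfderiv 𝓘(ℝ, E) v y (W y)) x u
      - mvfderiv 𝓘(ℝ, E) v x (g.leviCivita W x u) := by
  have hu : ∀ W : (∀ x : M, TangentSpace 𝓘(ℝ, E) x),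
      g.leviCivita W x u = g.nabla (extend E u) W x := fun W ↦ by simp [nabla]
  refine eq_of_tensorial (x := x)
    (fun W ↦ mvfderiv 𝓘(ℝ, E) (fun y ↦ mvfderiv 𝓘(ℝ, E) v y (W y)) x u
      - mvfderiv 𝓘(ℝ, E) v x (g.leviCivita W x u)) ?_ ?_ ?_ (smoothNear_extend (W x)) hW (by simp)
  · intro X Y hX hY
    simp only [hu, g.nabla_add hX hY, Pi.add_apply, map_add]
    rw [mvfderiv_fun_add (hv.dir hX).mdiff (hv.dir hY).mdiff, add_apply]
    ring
  · intro f X hf hX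
    simp only [hu, g.nabla_smul hf hX, Pi.smul_apply', map_add, map_smul, smul_eq_mul,
      extend_apply_self]
    rw [mvfderiv_fun_mul hf.mdiff (hv.dir hX).mdiff]
    simp only [add_apply, smul_apply, smul_eq_mul]
    ring
  · intro X Y hX e
    simp only [hu X, hu Y, g.nabla_congr hX e]
    rw [mvfderiv_congr (e.mono fun y hy ↦ by rw [hy])]

end LorentzianMetric

namespace LorentzianAlmostParacontact.IsLPKenmotsu

variable {P : LorentzianAlmostParacontact E M} {σ μ : ℝ}

/-- On an LP-Kenmotsu manifold, a function with `Hess v + σ S + μ g = 0` for constants `σ`, `μ`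
satisfies `dv = -ζ(v) ν` and `d(ζ(v)) = -(σ (n - 1) + μ) ν`. -/
theorem mvfderiv_of_hessian (hP : P.IsLPKenmotsu) (hv : ∀ x, SmoothFunNear E v x)
    (h : ∀ (x : M) (u w : TangentSpace 𝓘(ℝ, E) x),
      P.g.hessian v x u w + σ * P.g.ricci x u w + μ * P.g.val x u w = 0)
    (x : M) (u : TangentSpace 𝓘(ℝ, E) x) :
    mvfderiv 𝓘(ℝ, E) v x u = -mvfderiv 𝓘(ℝ, E) v x (P.ζ x) * P.ν x u ∧
    mvfderiv 𝓘(ℝ, E) (fun y ↦ mvfderiv 𝓘(ℝ, E) v y (P.ζ y)) x u =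
      -(σ * (finrank ℝ E - 1) + μ) * P.ν x u := by
  set κ : ℝ := σ * (finrank ℝ E - 1) + μ with hκ
  set f : M → ℝ := fun y ↦ mvfderiv 𝓘(ℝ, E) v y (P.ζ y) with hf_def
  have hf : ∀ x, SmoothFunNear E f x := fun x ↦ (hv x).dir (P.smoothNear_ζ x)
  -- The soliton equation on the pair (u, ζ), with ∇ζ and S(·,ζ) inserted: df + dv = -(f+κ)ν.
  have h1 : ∀ (x : M) (u : TangentSpace 𝓘(ℝ, E) x),
      mvfderiv 𝓘(ℝ, E) f x u + mvfderiv 𝓘(ℝ, E) v x u = -(f x + κ) * P.ν x u := by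
    intro x u
    have h0 := h x u (P.ζ x)
    rw [P.g.hessian_eq (hv x) (P.smoothNear_ζ x), hP.leviCivita_ζ, hP.ricci_ζ, P.g_ζ, map_sub,
      map_neg, map_smul, smul_eq_mul] at h0
    change mvfderiv 𝓘(ℝ, E) f x u - (-mvfderiv 𝓘(ℝ, E) v x u - P.ν x u * f x) + _ + _ = 0 at h0
    rw [hκ]
    linarith
  have h2 : ∀ {X Y : ∀ x : M, TangentSpace 𝓘(ℝ, E) x}, SmoothNear X x → SmoothNear Y x →
      mvfderiv 𝓘(ℝ, E) (fun y ↦ mvfderiv 𝓘(ℝ, E) (f + v) y (Y y)) x (X x) =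
        -(mvfderiv 𝓘(ℝ, E) f x (X x) * P.ν x (Y x)) - (f x + κ) *
          (P.ν x (P.g.nabla X Y x) - P.g.val x (X x) (Y x) - P.ν x (X x) * P.ν x (Y x)) := by
    intro X Y hX hY
    have e : (fun y ↦ mvfderiv 𝓘(ℝ, E) (f + v) y (Y y)) =
        fun y ↦ -((f y + κ) * P.ν y (Y y)) := by
      funext y
      rw [mvfderiv_add (hf y).mdiff (hv y).mdiff, add_apply, h1]
      ring
    have hfκ : SmoothFunNear E (fun y ↦ f y + κ) x := (hf x).add (SmoothFunNear.const κ)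
    have hd : mvfderiv 𝓘(ℝ, E) (fun y ↦ f y + κ) x = mvfderiv 𝓘(ℝ, E) f x := by
      rw [mvfderiv_fun_add (hf x).mdiff mdifferentiableAt_const, mvfderiv_const, add_zero]
    rw [e, mvfderiv_fun_neg, mvfderiv_fun_mul hfκ.mdiff (P.smoothFunNear_ν hY).mdiff, hd]
    simp only [add_apply, smul_apply, neg_apply, smul_eq_mul, hP.mvfderiv_ν hY]
    ring
  -- Exactness of d(f + v) and closedness of ν give df∧ν = 0, here contracted with ζ.
  have h3 : ∀ u : TangentSpace 𝓘(ℝ, E) x,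
      mvfderiv 𝓘(ℝ, E) f x u = -mvfderiv 𝓘(ℝ, E) f x (P.ζ x) * P.ν x u := by
    intro u
    have hX : SmoothNear (extend E u) x := smoothNear_extend u
    have hζ := P.smoothNear_ζ x
    have hb := mvfderiv_mlieBracket ((hf x).add (hv x)) hX hζ
    rw [h2 hX hζ, h2 hζ hX, mvfderiv_add (hf x).mdiff (hv x).mdiff, add_apply, h1,
      P.g.mlieBracket_eq hX hζ] at hb
    simp only [extend_apply_self, P.ν_apply_ζ, map_sub, P.val_ζ_left, P.g_ζ] at hb
    linarith
  have h4 : mvfderiv 𝓘(ℝ, E) f x (P.ζ x) = κ := by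
    have h5 := h1 x (P.ζ x)
    rw [P.ν_apply_ζ] at h5
    change _ + f x = _ at h5
    linarith
  rw [h4] at h3
  refine ⟨?_, h3 u⟩
  have h6 := h1 x u
  rw [h3 u] at h6
  change _ = -f x * _
  linarith

/-- On an LP-Kenmotsu manifold of dimension at least two, a function with
`Hess v + σ S + μ g = 0` for constants `σ`, `μ` has vanishing differential. -/
theorem mvfderiv_eq_zero_of_hessian (hP : P.IsLPKenmotsu) (hn : 2 ≤ finrank ℝ E)
    (hv : ∀ x, SmoothFunNear E v x)
    (h : ∀ (x : M) (u w : TangentSpace 𝓘(ℝ, E) x),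
      P.g.hessian v x u w + σ * P.g.ricci x u w + μ * P.g.val x u w = 0) (x : M) :
    mvfderiv 𝓘(ℝ, E) v x = 0 := by
  have hdv := fun x u ↦ (hP.mvfderiv_of_hessian hv h x u).1
  have hdf := fun x u ↦ (hP.mvfderiv_of_hessian hv h x u).2
  set κ : ℝ := σ * (finrank ℝ E - 1) + μ with hκ
  set f : M → ℝ := fun y ↦ mvfderiv 𝓘(ℝ, E) v y (P.ζ y) with hf_def
  have hf : ∀ x, SmoothFunNear E f x := fun x ↦ (hv x).dir (P.smoothNear_ζ x)
  -- From dv = -fν and df = -κν, the Hessian is κ ν⊗ν + f(g + ν⊗ν); substitute it in the soliton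
  -- equation.
  have hS : ∀ (x : M) (u w : TangentSpace 𝓘(ℝ, E) x), σ * P.g.ricci x u w =
      -(μ * P.g.val x u w) - κ * (P.ν x u * P.ν x w)
        - f x * (P.g.val x u w + P.ν x u * P.ν x w) := by
    intro x u w
    have hU : SmoothNear (extend E u) x := smoothNear_extend u
    have hW : SmoothNear (extend E w) x := smoothNear_extend w
    have h0 := h x u w
    have h1 := P.g.hessian_eq (hv x) hW u
    have e : (fun y ↦ mvfderiv 𝓘(ℝ, E) v y (extend E w y)) =
        fun y ↦ -(f y * P.ν y (extend E w y)) :=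
      funext fun y ↦ by rw [hdv]; exact neg_mul _ _
    have h2 := hP.mvfderiv_ν (X := extend E u) hW
    rw [LorentzianMetric.nabla, extend_apply_self, extend_apply_self] at h2
    rw [e, mvfderiv_fun_neg, mvfderiv_fun_mul (hf x).mdiff (P.smoothFunNear_ν hW).mdiff,
      neg_apply, add_apply, smul_apply, smul_apply, h2, hdf, hdv, extend_apply_self] at h1
    simp only [smul_eq_mul] at h1
    rw [h1] at h0
    change _ - -f x * _ + _ + _ = 0 at h0
    linarith
  have key : ∀ (x : M) (u w : TangentSpace 𝓘(ℝ, E) x),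
      (κ + 2 * f x) * (P.g.val x u w + P.ν x u * P.ν x w) = 0 := by
    intro x u w
    set Y : ∀ x : M, TangentSpace 𝓘(ℝ, E) x := extend E u
    set Z : ∀ x : M, TangentSpace 𝓘(ℝ, E) x := extend E w
    have hY : SmoothNear Y x := smoothNear_extend u
    have hZ : SmoothNear Z x := smoothNear_extend w
    have hYx : Y x = u := extend_apply_self E u
    have hZx : Z x = w := extend_apply_self E w
    have hν := P.smoothFunNear_ν hY
    have hν' := P.smoothFunNear_ν hZ
    have hg := hY.metric P.g hZ
    have hR := P.g.smoothFunNear_ricci hY hZ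
    have hc := fun c : ℝ ↦ SmoothFunNear.const (E := E) (x := x) c
    have hνν := hν.mul hν'
    have e : (fun _ ↦ σ) * (fun y ↦ P.g.ricci y (Y y) (Z y)) =
        -((fun _ ↦ μ) * fun y ↦ P.g.val y (Y y) (Z y))
          - (fun _ ↦ κ) * ((fun y ↦ P.ν y (Y y)) * fun y ↦ P.ν y (Z y))
          - f * ((fun y ↦ P.g.val y (Y y) (Z y))
            + (fun y ↦ P.ν y (Y y)) * fun y ↦ P.ν y (Z y)) := funext fun y ↦ hS y _ _
    -- Differentiate `hS` along ζ. The terms containing ∇_ζ Y and ∇_ζ Z are instances of `hS` itself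
    -- (`s1`, `s2`), so only ∇_ζ S and df(ζ) = κ survive.
    have hd := congrArg (fun F ↦ mvfderiv 𝓘(ℝ, E) F x (P.ζ x)) e
    beta_reduce at hd
    rw [mvfderiv_mul (hc σ).mdiff hR.mdiff,
      mvfderiv_sub (((hc μ).mul hg).mdiff.neg.sub ((hc κ).mul hνν).mdiff)
        ((hf x).mul (hg.add hνν)).mdiff,
      mvfderiv_sub ((hc μ).mul hg).mdiff.neg ((hc κ).mul hνν).mdiff, mvfderiv_neg,
      mvfderiv_mul (hc μ).mdiff hg.mdiff, mvfderiv_mul (hc κ).mdiff hνν.mdiff,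
      mvfderiv_mul (hf x).mdiff (hg.add hνν).mdiff, mvfderiv_add hg.mdiff hνν.mdiff,
      mvfderiv_mul hν.mdiff hν'.mdiff] at hd
    simp only [add_apply, sub_apply, neg_apply, smul_apply, smul_eq_mul, mvfderiv_const,
      Pi.add_apply, Pi.mul_apply,
      zero_apply, hP.mvfderiv_ν hY, hP.mvfderiv_ν hZ, P.g.mvfderiv_inner hY hZ, hdf,
      hP.mvfderiv_ricci_ζ hY hZ, P.ν_apply_ζ, P.val_ζ_left, hYx, hZx] at hd
    have s1 := hS x (P.g.nabla P.ζ Y x) w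
    have s2 := hS x u (P.g.nabla P.ζ Z x)
    have s3 := hS x u w
    rw [hκ] at s1 s2 s3 hd ⊢
    linarith
  have hfκ : ∀ x, f x = -κ / 2 := by
    intro x
    by_contra hne
    have hne' : κ + 2 * f x ≠ 0 := fun h0 ↦ hne (by linarith)
    -- Otherwise g = -ν⊗ν at x, so that u = -ν(u)ζ for every u and the tangent space is a line.
    have hle : finrank ℝ (TangentSpace 𝓘(ℝ, E) x) ≤ 1 := by
      refine finrank_le_one (P.ζ x) fun u ↦ ⟨-P.ν x u, P.g.ext_of_forall fun w ↦ ?_⟩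
      have h0 := (mul_eq_zero.mp (key x u w)).resolve_left hne'
      rw [map_smul, smul_apply, P.val_ζ_left, smul_eq_mul]
      linarith
    have hrank : finrank ℝ (TangentSpace 𝓘(ℝ, E) x) = finrank ℝ E := rfl
    omega
  -- Here f is constant, while df = -κν and ν(ζ) = -1 give df(ζ) = κ.
  have hκ0 : κ = 0 := by
    have h1 := hdf x (P.ζ x)
    rw [P.ν_apply_ζ, show f = fun _ ↦ -κ / 2 from funext hfκ, mvfderiv_const] at h1
    simpa using h1.symm
  ext u
  rw [hdv, show mvfderiv 𝓘(ℝ, E) v x (P.ζ x) = f x from rfl, hfκ, hκ0]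
  simp

end LorentzianAlmostParacontact.IsLPKenmotsu

end Soliton

theorem theorem4p2 {E : Type*} [NormedAddCommGroup E] [NormedSpace ℝ E] [FiniteDimensional ℝ E]
    (hn : 2 ≤ finrank ℝ E)
    {M : Type*} [TopologicalSpace M] [T2Space M] [SecondCountableTopology M] [ConnectedSpace M]
    [ChartedSpace E M] [IsManifold 𝓘(ℝ, E) ∞ M]
    (P : LorentzianAlmostParacontact E M) (hP : P.IsLPKenmotsu)
    (hr : ∃ r₀ : ℝ, ∀ x, P.g.scalarCurvature x = r₀)
    (σ ρ Λ : ℝ) (v : M → ℝ) (hv : P.g.IsGradientRicciYamabeSoliton v σ ρ Λ) :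
    ∃ c : ℝ, ∀ x, v x = c := by
  obtain ⟨r₀, hr⟩ := hr
  have hsm : ∀ x, SmoothFunNear E v x := fun x ↦ Eventually.of_forall fun y ↦ hv.contMDiff y
  -- Constancy of the scalar curvature makes the coefficient of g a constant `μ`, so it can be
  -- treated as such under differentiation.
  have hd := hP.mvfderiv_eq_zero_of_hessian (σ := σ) (μ := Λ - ρ * r₀ / 2) hn hsm
    fun x u w ↦ by rw [← hr x]; exact hv.eq_zero x u w
  have hloc := isLocallyConstant_of_mvfderiv_eq_zero (fun x ↦ (hsm x).mdiff) hd
  obtain ⟨x₀⟩ := (inferInstance : Nonempty M)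
  exact ⟨v x₀, fun x ↦ hloc.apply_eq_of_preconnectedSpace x x₀⟩
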